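/- **Theorem.** Let $D\ge 3$ be an odd integer and $\mathcal D=(D-1)/2$. Let $Q_D$ be the hypercube with vertex set $\mathcal X=\{0,1\}^D$, and let $\tilde Q_D$ be its antipodal quotient: its vertices are the classes $[\mathbf y]=\{\mathbf y,\mathbf y'\}$, where $\mathbf y'$ is the antipode of $\mathbf y$, and two classes are adjacent when they contain adjacent vertices of $Q_D$. Write $\tilde{\mathcal X}$ for the vertex set of $\tilde Q_D$, fix $\mathbf x\in\mathcal X$, and let $\tilde V=\mathbb C^{\tilde{\mathcal X}}$ be the standard module. Let $\tilde{\mathbf A}$ be the adjacency matrix of $\tilde Q_D$. Order its distinct eigenvalues as $\theta_i=(-1)^i(D-2i)$ $(0\le i\le\mathcal D)$, and let $\tilde{\mathbf E}_1=\prod_{0\le j\le \mathcal D,\,j\ne1}\frac{\tilde{\mathbf A}-\theta_j\mathbf I}{\theta_1-\theta_j}$ be the primitive idempotent for $\theta_1$. Let $\tilde{\mathbf B}$ be the dual adjacency matrix with respect to $[\mathbf x]$, that is, the diagonal matrix with $(\mathbf u,\mathbf u)$-entry $|\tilde{\mathcal X}|\,(\tilde{\mathbf E}_1)_{[\mathbf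 x]\mathbf u}$. Let $\tilde T$ be the Terwilliger algebra of $\tilde Q_D$ with respect to $[\mathbf x]$, generated by $\tilde{\mathbf A}$ and the diagonal $0$-$1$ matrices $\tilde{\mathbf E}^*_i$ that indicate the vertices at distance $i$ from $[\mathbf x]$. A $\tilde T$-module is a subspace of $\tilde V$ that is invariant under $\tilde T$; it is irreducible when it is nonzero and contains no $\tilde T$-modules other than $0$ and itself. Let $\mathcal A$ be the unital associative $\mathbb C$-algebra with generators $x,y,z$ and relations $xy+yx=2z$, $yz+zy=2x$, $zx+xz=2y$. Then there is a unique $\mathcal A$-module structure on $\tilde V$ such that $x,y$ act as $\tilde{\mathbf A},\tilde{\mathbf B}$ respectively; let $\tilde{\mathbf C}$ be the matrix that represents the action of $z$. Every irreducible $\tilde T$-module $W$ is invariant under $\tilde{\mathbf A},\tilde{\mathbf B},\tilde{\mathbf C}$, and the actions of $\tilde{\mathbf A},\tilde{\mathbf B},\tilde{\mathbf C}$ on $W$ form a totally almost bipartite Leonard triple of Bannai/Ito type. Here a *Leonard triple* on a vector space $W$ of dimension $d+1$, $0\le d<\infty$, is an ordered triple of linear maps $W\to W$ such that for each of the three maps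 there is a basis of $W$ (with vectors indexed $0,\dots,d$) with respect to which that map is represented by a diagonal matrix and each of the other two by an irreducible tridiagonal matrix (all entries on the sub- and superdiagonal are nonzero). It is *totally almost bipartite* when, for all such bases, each of the six tridiagonal matrices $N$ satisfies: $N_{ii}=0$ for $1\le i\le d-1$, and exactly one of the corner positions $(0,0)$, $(d,d)$ carries a nonzero entry (for $d=0$ the two positions coincide, and the condition is $N_{00}\neq0$). It is of *Bannai/Ito type* when, for any basis as above in which the first map is diagonal, with eigenvalues $\theta_0,\dots,\theta_d$ in this order, $(\theta_{i-2}-\theta_{i+1})/(\theta_{i-1}-\theta_i)=-1$ for $2\le i\le d-1$. -/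

import Mathlib

/-! ## Leonard triples -/

section Leonard

variable {K V : Type*} [Field K] [AddCommGroup V] [Module K V] {d : ℕ}

/-- Irreducible tridiagonal: every nonzero entry lies on the diagonal, the subdiagonal or the
superdiagonal, and all entries on the subdiagonal and the superdiagonal are nonzero. -/
def IsIrreducibleTridiagonal (B : Matrix (Fin (d + 1)) (Fin (d + 1)) K) : Prop :=
  (∀ i j : Fin (d + 1), B i j ≠ 0 →
    (i : ℕ) = (j : ℕ) ∨ (i : ℕ) + 1 = (j : ℕ) ∨ (j : ℕ) + 1 = (i : ℕ)) ∧
  ∀ i j : Fin (d + 1), (i : ℕ) + 1 = (j : ℕ) → B i j ≠ 0 ∧ B j i ≠ 0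

/-- Almost bipartite (for a tridiagonal matrix): among the diagonal entries, exactly one of the
two corner positions `0`, `d` carries a nonzero entry, and all the other entries vanish.
For `d = 0` the two corner positions coincide, and the condition says that the only entry is
nonzero. -/
def IsAlmostBipartite (B : Matrix (Fin (d + 1)) (Fin (d + 1)) K) : Prop :=
  (∃! i : Fin (d + 1), (i = 0 ∨ i = Fin.last d) ∧ B i i ≠ 0) ∧
  ∀ i : Fin (d + 1), i ≠ 0 → i ≠ Fin.last d → B i i = 0

/-- With respect to the basis `b`, the map `A` is diagonal and `A'`, `A''` are irreducible
tridiagonal. -/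
def IsStandardBasis (b : Module.Basis (Fin (d + 1)) K V) (A A' A'' : Module.End K V) : Prop :=
  (LinearMap.toMatrix b b A).IsDiag ∧
  IsIrreducibleTridiagonal (LinearMap.toMatrix b b A') ∧
  IsIrreducibleTridiagonal (LinearMap.toMatrix b b A'')

/-- Leonard triples on `V`. (That `V` has finite positive dimension `d + 1` is part of the
condition; `d` is the diameter.) -/
def IsLeonardTriple (A A' A'' : Module.End K V) : Prop :=
  ∃ d : ℕ,
    (∃ b : Module.Basis (Fin (d + 1)) K V, IsStandardBasis b A A' A'') ∧
    (∃ b : Module.Basis (Fin (d + 1)) K V, IsStandardBasis b A' A'' A) ∧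
    (∃ b : Module.Basis (Fin (d + 1)) K V, IsStandardBasis b A'' A A')

/-- Totally almost bipartite Leonard triples: all six tridiagonal matrices that occur in the
definition of a Leonard triple are almost bipartite (for every choice of the three bases). -/
def IsTotallyAlmostBipartiteLeonardTriple (A A' A'' : Module.End K V) : Prop :=
  IsLeonardTriple A A' A'' ∧
  ∀ (d : ℕ) (b : Module.Basis (Fin (d + 1)) K V),
    (IsStandardBasis b A A' A'' →
      IsAlmostBipartite (LinearMap.toMatrix b b A') ∧
      IsAlmostBipartite (LinearMap.toMatrix b b A'')) ∧
    (IsStandardBasis b A' A'' A →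
      IsAlmostBipartite (LinearMap.toMatrix b b A'') ∧
      IsAlmostBipartite (LinearMap.toMatrix b b A)) ∧
    (IsStandardBasis b A'' A A' →
      IsAlmostBipartite (LinearMap.toMatrix b b A) ∧
      IsAlmostBipartite (LinearMap.toMatrix b b A'))

/-- Bannai/Ito type: if `θ 0, …, θ d` are the eigenvalues of `A` on a standard basis, then
`(θ (i-2) - θ (i+1)) / (θ (i-1) - θ i) = -1` for `2 ≤ i ≤ d - 1`
(below, `i` is shifted by two). -/
def IsBannaiItoType (A A' A'' : Module.End K V) : Prop :=
  ∀ (d : ℕ) (b : Module.Basis (Fin (d + 1)) K V), IsStandardBasis b A A' A'' →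
    ∀ θ : Fin (d + 1) → K, (∀ i, A (b i) = θ i • b i) →
      ∀ (i : ℕ) (hi : i + 3 < d + 1),
        (θ ⟨i, by omega⟩ - θ ⟨i + 3, hi⟩) / (θ ⟨i + 1, by omega⟩ - θ ⟨i + 2, by omega⟩) = -1

end Leonard

/-! ## The anticommutator spin algebra -/

/-- The defining relations `xy + yx = 2z`, `yz + zy = 2x`, `zx + xz = 2y`, where `x, y, z` are the
free generators `0, 1, 2`. -/
inductive AnticommutatorSpinRel (K : Type*) [CommRing K] :
    FreeAlgebra K (Fin 3) → FreeAlgebra K (Fin 3) → Prop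
  | xy : AnticommutatorSpinRel K
      (FreeAlgebra.ι K 0 * FreeAlgebra.ι K 1 + FreeAlgebra.ι K 1 * FreeAlgebra.ι K 0)
      (2 * FreeAlgebra.ι K 2)
  | yz : AnticommutatorSpinRel K
      (FreeAlgebra.ι K 1 * FreeAlgebra.ι K 2 + FreeAlgebra.ι K 2 * FreeAlgebra.ι K 1)
      (2 * FreeAlgebra.ι K 0)
  | zx : AnticommutatorSpinRel K
      (FreeAlgebra.ι K 2 * FreeAlgebra.ι K 0 + FreeAlgebra.ι K 0 * FreeAlgebra.ι K 2)
      (2 * FreeAlgebra.ι K 1)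

/-- The anticommutator spin algebra over `K`. -/
abbrev AnticommutatorSpinAlgebra (K : Type*) [CommRing K] : Type _ :=
  RingQuot (AnticommutatorSpinRel K)

namespace AnticommutatorSpinAlgebra

variable (K : Type*) [CommRing K]

/-- The generator `x`. -/
noncomputable def x : AnticommutatorSpinAlgebra K :=
  RingQuot.mkAlgHom K (AnticommutatorSpinRel K) (FreeAlgebra.ι K 0)

/-- The generator `y`. -/
noncomputable def y : AnticommutatorSpinAlgebra K :=
  RingQuot.mkAlgHom K (AnticommutatorSpinRel K) (FreeAlgebra.ι K 1)

/-- The generator `z`. -/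
noncomputable def z : AnticommutatorSpinAlgebra K :=
  RingQuot.mkAlgHom K (AnticommutatorSpinRel K) (FreeAlgebra.ι K 2)

end AnticommutatorSpinAlgebra

/-! ## The Terwilliger algebra of a graph -/

section Terwilliger

variable {X : Type*} [Fintype X] [DecidableEq X] (Γ : SimpleGraph X) [DecidableRel Γ.Adj]

/-- The Bose-Mesner algebra: the algebra generated by the adjacency matrix. -/
noncomputable def boseMesnerAlgebra : Subalgebra ℂ (Matrix X X ℂ) :=
  Algebra.adjoin ℂ {Γ.adjMatrix ℂ}

/-- The `i`-th dual idempotent with respect to the vertex `x`. -/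
noncomputable def dualIdempotent (x : X) (i : ℕ) : Matrix X X ℂ :=
  Matrix.diagonal fun y => if Γ.dist x y = i then 1 else 0

/-- The dual Bose-Mesner algebra with respect to the vertex `x`. -/
noncomputable def dualBoseMesnerAlgebra (x : X) : Subalgebra ℂ (Matrix X X ℂ) :=
  Algebra.adjoin ℂ (Set.range (dualIdempotent Γ x))

/-- The Terwilliger algebra with respect to the vertex `x`. -/
noncomputable def terwilligerAlgebra (x : X) : Subalgebra ℂ (Matrix X X ℂ) :=
  boseMesnerAlgebra Γ ⊔ dualBoseMesnerAlgebra Γ x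

/-- `W` is a module for the matrix algebra `T` inside the standard module `ℂ^X`. -/
def IsMatrixSubmodule (T : Subalgebra ℂ (Matrix X X ℂ)) (W : Submodule ℂ (X → ℂ)) : Prop :=
  ∀ N ∈ T, ∀ w ∈ W, N.mulVec w ∈ W

/-- `W` is an irreducible module for the matrix algebra `T` inside the standard module. -/
def IsIrreducibleMatrixSubmodule (T : Subalgebra ℂ (Matrix X X ℂ))
    (W : Submodule ℂ (X → ℂ)) : Prop :=
  IsMatrixSubmodule T W ∧ W ≠ ⊥ ∧
    ∀ U : Submodule ℂ (X → ℂ), IsMatrixSubmodule T U → U ≤ W → U = ⊥ ∨ U = W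

/-- The primitive idempotent of the adjacency matrix `A` for the eigenvalue `θ i`, where
`θ 0, …, θ n` are the distinct eigenvalues of `A`: the product of
`(A - θ j) / (θ i - θ j)` over all `0 ≤ j ≤ n` with `j ≠ i`. -/
noncomputable def primitiveIdempotent (n : ℕ) (θ : ℕ → ℂ) (i : ℕ) : Matrix X X ℂ :=
  Polynomial.aeval (Γ.adjMatrix ℂ) (Lagrange.basis (Finset.range (n + 1)) θ i)

/-- The dual adjacency matrix with respect to the vertex `x` and the ordering `θ 0, …, θ n` of the
eigenvalues: diagonal, with `(y, y)`-entry `|X| (E₁)_{x y}`. -/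
noncomputable def dualAdjacencyMatrix (n : ℕ) (θ : ℕ → ℂ) (x : X) : Matrix X X ℂ :=
  Matrix.diagonal fun y => (Fintype.card X : ℂ) * primitiveIdempotent Γ n θ 1 x y

end Terwilliger

/-! ## The hypercube and its antipodal quotient -/

/-- The hypercube `Q_D`: two vertices are adjacent when they differ in exactly one coordinate. -/
def hypercube (D : ℕ) : SimpleGraph (Fin D → Bool) where
  Adj y z := hammingDist y z = 1
  symm := ⟨fun y z h => by rw [hammingDist_comm]; exact h⟩
  loopless := ⟨fun y h => by simp at h⟩

instance (D : ℕ) : DecidableRel (hypercube D).Adj :=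
  fun y z => inferInstanceAs (Decidable (hammingDist y z = 1))

/-- The antipode of a vertex of `Q_D`: all the coordinates are changed. -/
def antipode {D : ℕ} (y : Fin D → Bool) : Fin D → Bool := fun i => !(y i)

/-- The antipode of `y` is the unique vertex that differs from `y` in all `D` coordinates. -/
theorem eq_antipode_iff {D : ℕ} (y z : Fin D → Bool) : z = antipode y ↔ hammingDist y z = D := by
  constructor
  · rintro rfl
    simp [hammingDist, antipode]
  · intro h
    have h1 : (Finset.univ.filter fun i => y i ≠ z i) = Finset.univ := by
      apply Finset.eq_univ_of_card
      simpa [hammingDist] using h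
    funext i
    have h2 : y i ≠ z i := by
      have := Finset.mem_univ i
      rw [← h1] at this
      simpa using this
    simp only [antipode]
    cases hy : y i <;> cases hz : z i <;> simp_all

theorem antipode_antipode {D : ℕ} (y : Fin D → Bool) : antipode (antipode y) = y := by
  funext i; simp [antipode]

/-- Two vertices of `Q_D` are equivalent when they are equal or antipodal. -/
def antipodalSetoid (D : ℕ) : Setoid (Fin D → Bool) where
  r y z := y = z ∨ antipode y = z
  iseqv := by
    refine ⟨fun y => Or.inl rfl, ?_, ?_⟩
    · rintro y z (rfl | rfl)
      · exact Or.inl rfl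
      · exact Or.inr (antipode_antipode y)
    · rintro y z w (rfl | rfl) (rfl | rfl)
      · exact Or.inl rfl
      · exact Or.inr rfl
      · exact Or.inr rfl
      · exact Or.inl (antipode_antipode y).symm

instance (D : ℕ) : DecidableRel (antipodalSetoid D).r :=
  fun y z => inferInstanceAs (Decidable (y = z ∨ antipode y = z))

/-- The vertex set of the antipodal quotient of `Q_D`. -/
def AntipodalVertex (D : ℕ) : Type := Quotient (antipodalSetoid D)

/-- The vertex `[y]` of the antipodal quotient. -/
def AntipodalVertex.mk {D : ℕ} (y : Fin D → Bool) : AntipodalVertex D :=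
  Quotient.mk (antipodalSetoid D) y

instance (D : ℕ) : DecidableEq (AntipodalVertex D) :=
  @Quotient.decidableEq _ (antipodalSetoid D)
    (fun y z => inferInstanceAs (Decidable (y = z ∨ antipode y = z)))

instance (D : ℕ) : Fintype (AntipodalVertex D) :=
  @Quotient.fintype _ _ (antipodalSetoid D)
    (fun y z => inferInstanceAs (Decidable (y = z ∨ antipode y = z)))

/-- The antipodal quotient of `Q_D`: distinct classes are adjacent when they contain adjacent
vertices of `Q_D`. (For `D ≠ 1` adjacent vertices of `Q_D` always lie in distinct classes, so that
distinctness only excludes the loop for `D = 1`.) -/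
def antipodalQuotient (D : ℕ) : SimpleGraph (AntipodalVertex D) where
  Adj u v := u ≠ v ∧ ∃ y z : Fin D → Bool,
    AntipodalVertex.mk y = u ∧ AntipodalVertex.mk z = v ∧ (hypercube D).Adj y z
  symm := ⟨fun u v h => by
    obtain ⟨hne, y, z, hy, hz, hyz⟩ := h
    exact ⟨hne.symm, z, y, hz, hy, hyz.symm⟩⟩
  loopless := ⟨fun u h => h.1 rfl⟩

instance (D : ℕ) : DecidableRel (antipodalQuotient D).Adj :=
  fun u v => inferInstanceAs (Decidable (u ≠ v ∧ ∃ y z : Fin D → Bool,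
    AntipodalVertex.mk y = u ∧ AntipodalVertex.mk z = v ∧ (hypercube D).Adj y z))

/-- The ordering `(-1)^i (D - 2i)` of the eigenvalues of the antipodal quotient, `D` odd and
`0 ≤ i ≤ (D - 1) / 2`. -/
noncomputable def antipodalEigenvalue (D i : ℕ) : ℂ := (-1) ^ i * ((D : ℂ) - 2 * (i : ℂ))

/-- The adjacency matrix of the antipodal quotient. -/
noncomputable def quotientAdjacency (D : ℕ) : Matrix (AntipodalVertex D) (AntipodalVertex D) ℂ :=
  (antipodalQuotient D).adjMatrix ℂ

/-- The dual adjacency matrix of the antipodal quotient (of diameter `⌊D / 2⌋`) with respect to the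
vertex `u` and the ordering `(-1)^i (D - 2i)` of the eigenvalues. -/
noncomputable def quotientDualAdjacency (D : ℕ) (u : AntipodalVertex D) :
    Matrix (AntipodalVertex D) (AntipodalVertex D) ℂ :=
  dualAdjacencyMatrix (antipodalQuotient D) (D / 2) (antipodalEigenvalue D) u

/-- The Terwilliger algebra of the antipodal quotient with respect to the vertex `u`. -/
noncomputable def quotientTerwilliger (D : ℕ) (u : AntipodalVertex D) :
    Subalgebra ℂ (Matrix (AntipodalVertex D) (AntipodalVertex D) ℂ) :=
  terwilligerAlgebra (antipodalQuotient D) u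

/-! Two facts carry the theorem: a concrete description of `A`, `B`, `C` as sums of involutions, and
the structure of irreducible modules for the spin relations.

On functions on the quotient, let `X i` flip the coordinate `i` and let `Y i` multiply by the
character of the complement of `i`, normalised at the base vertex. That complement has even size `D
- 1`, so the character descends to antipodal classes. `X i` and `Y i` commute, since flipping `i`
does not touch the complement, while `X i` and `Y j` anticommute for `i ≠ j`. The adjacency matrix
is `∑ X i`. The characters of these complements span the `θ₁`-eigenspace, so the dual adjacency
matrix is `∑ Y i`. With `C = ∑ X i * Y i` the cross terms cancel in each anticommutator and the
three relations follow. Each of `A`, `B`, `C` is a sum of `D` commuting involutions, so its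
eigenvalues are odd integers. The dual eigenvalues `θ_i` are distinct, so the dual idempotents are
polynomials in `B`; hence `A` and `B` generate the Terwilliger algebra, and an irreducible module
for it is irreducible under the triple (`isMatrixSubmodule_of_invariant`).

On an irreducible module the Casimir `A² + B² + C²` is a scalar `ω`. For `η = ±1`, `B - η C` maps
the `β`-eigenspace of `A` to the one for `-2η - β`, and its square is `ω - A² - 2ηA`. So odd
eigenvalues move by 2 in absolute value, and comparing the largest with the smallest forces an
eigenvalue `±1`. From a suitable vector there, a chain of eigenvectors with eigenvalues `±1, ∓3, ±5,
…` spans the module (`exists_isChainBasis`): `A` has simple spectrum, `B` and `C` are irreducible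
tridiagonal, and `B` has nonzero trace. The relations are cyclically symmetric, so this gives all
three bases. For an arbitrary standard basis, comparing matrix entries in the relations yields the
almost bipartite and Bannai/Ito conditions. -/

/-! ### Irreducible modules for the spin relations -/

section SpinTriple

variable {V : Type*} [AddCommGroup V] [Module ℂ V]

/-- Three linear maps that satisfy the relations of the anticommutator spin algebra. -/
structure IsSpinTriple (A B C : Module.End ℂ V) : Prop where
  ab : ∀ v, A (B v) + B (A v) = (2 : ℂ) • C v
  bc : ∀ v, B (C v) + C (B v) = (2 : ℂ) • A v
  ca : ∀ v, C (A v) + A (C v) = (2 : ℂ) • B v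

/-- There are no proper nonzero subspaces invariant under all three maps. -/
def IsIrreducibleTriple (A B C : Module.End ℂ V) : Prop :=
  ∀ U : Submodule ℂ V, (∀ v ∈ U, A v ∈ U) → (∀ v ∈ U, B v ∈ U) → (∀ v ∈ U, C v ∈ U) →
    U = ⊥ ∨ U = ⊤

/-- The map has an eigenvalue that is an odd integer. -/
def HasOddEigenvalue (A : Module.End ℂ V) : Prop :=
  ∃ n : ℕ, ∃ ε : ℂ, ε ^ 2 = 1 ∧ ∃ v ≠ 0, A v = (ε * (2 * n + 1)) • v

namespace IsSpinTriple

variable {A B C : Module.End ℂ V}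

theorem rotate (h : IsSpinTriple A B C) : IsSpinTriple B C A := ⟨h.bc, h.ca, h.ab⟩

theorem swap (h : IsSpinTriple A B C) : IsSpinTriple A C B where
  ab v := by rw [← h.ca v, add_comm]
  bc v := by rw [← h.bc v, add_comm]
  ca v := by rw [← h.ab v, add_comm]

/-- The map `B - η C` sends `A`-eigenvectors for `β` to `A`-eigenvectors for `-2 η - β`. -/
theorem apply_sub_smul (h : IsSpinTriple A B C) {η β : ℂ} (hη : η ^ 2 = 1) {v : V}
    (hv : A v = β • v) :
    A (B v - η • C v) = (-2 * η - β) • (B v - η • C v) := by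
  have h1 := h.ab v
  have h2 := h.ca v
  rw [hv, map_smul] at h1 h2
  rw [map_sub, map_smul, eq_sub_of_add_eq h1, eq_sub_of_add_eq' h2]
  have : (2 : ℂ) • C v = (2 * η ^ 2) • C v := by rw [hη, mul_one]
  rw [this]
  module

/-- The commutator of `A` with `B²` is `2(CB - BC)`, and with `C²` it is the negative of this. -/
theorem casimir_comm (h : IsSpinTriple A B C) (v : V) :
    A (A (A v) + B (B v) + C (C v)) = A (A (A v)) + B (B (A v)) + C (C (A v)) := by
  have h1 := h.ab (B v)
  have h2 := congrArg B (h.ab v)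
  have h3 := h.ca (C v)
  have h4 := congrArg C (h.ca v)
  simp only [map_add, map_smul] at *
  rw [eq_sub_of_add_eq h1, eq_sub_of_add_eq' h3, eq_sub_of_add_eq' h2, eq_sub_of_add_eq h4]
  abel

/-- The Casimir element acts as a scalar on an irreducible module. -/
theorem exists_casimir [FiniteDimensional ℂ V] [Nontrivial V] (h : IsSpinTriple A B C)
    (hirr : IsIrreducibleTriple A B C) :
    ∃ ω : ℂ, ∀ v, A (A v) + B (B v) + C (C v) = ω • v := by
  obtain ⟨ω, hω⟩ := Module.End.exists_eigenvalue (A * A + B * B + C * C)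
  refine ⟨ω, ?_⟩
  have hmem : ∀ v, v ∈ Module.End.eigenspace (A * A + B * B + C * C) ω ↔
      A (A v) + B (B v) + C (C v) = ω • v := fun v => by
    rw [Module.End.mem_eigenspace_iff]; rfl
  have h0 := hirr (Module.End.eigenspace (A * A + B * B + C * C) ω) (fun v hv => ?_)
    (fun v hv => ?_) (fun v hv => ?_)
  · intro v
    rw [← hmem, h0.resolve_left hω]
    trivial
  · rw [hmem] at *
    rw [← h.casimir_comm, hv, map_smul]
  · rw [hmem] at *
    have := h.rotate.casimir_comm v
    rw [show B (B v) + C (C v) + A (A v) = ω • v by rw [← hv]; abel, map_smul] at this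
    rw [this]
    abel
  · rw [hmem] at *
    have := h.rotate.rotate.casimir_comm v
    rw [show C (C v) + A (A v) + B (B v) = ω • v by rw [← hv]; abel, map_smul] at this
    rw [this]
    abel

/-- Expanding, `(B - ηC)² = B² + C² - η(BC + CB) = (ω - A²) - 2ηA`, a scalar on each eigenspace of
`A`. -/
theorem sq_sub_smul (h : IsSpinTriple A B C) {ω η β : ℂ} (hη : η ^ 2 = 1)
    (hω : ∀ v, A (A v) + B (B v) + C (C v) = ω • v) {v : V} (hv : A v = β • v) :
    B (B v - η • C v) - η • C (B v - η • C v) = (ω - β ^ 2 - 2 * η * β) • v := by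
  have h1 := h.bc v
  have h2 := hω v
  rw [hv, map_smul, hv] at h2
  rw [hv] at h1
  simp only [map_sub, map_smul]
  have e : B (B v) - η • B (C v) - η • (C (B v) - η • C (C v)) =
      B (B v) + η ^ 2 • C (C v) - η • (B (C v) + C (B v)) := by module
  have e2 : B (B v) + C (C v) = ω • v - β • β • v := by rw [← h2]; abel
  rw [e, h1, hη, one_smul, e2]
  module

/-- If the first map has an odd integer eigenvalue, then `1` or `-1` is an eigenvalue. -/
theorem exists_unit_eigenvector [FiniteDimensional ℂ V] (h : IsSpinTriple A B C) {ω : ℂ}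
    (hω : ∀ v, A (A v) + B (B v) + C (C v) = ω • v) (hodd : HasOddEigenvalue A) :
    ∃ ε : ℂ, ε ^ 2 = 1 ∧ ∃ v ≠ 0, A v = ε • v := by
  let S : Set ℕ := {n | ∃ ε : ℂ, ε ^ 2 = 1 ∧ ∃ v ≠ 0, A v = (ε * (2 * n + 1)) • v}
  have hne : S.Nonempty := hodd
  have hfin : S.Finite := by
    have hA : {μ : ℂ | A.HasEigenvalue μ}.Finite := Module.End.finite_hasEigenvalue A
    refine Set.Finite.of_finite_image (f := fun n : ℕ => ((2 * n + 1 : ℂ)) ^ 2)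
      ((hA.image fun μ => μ ^ 2).subset ?_) ?_
    · rintro _ ⟨n, ⟨ε, hε, v, hv0, hv⟩, rfl⟩
      refine ⟨ε * (2 * n + 1), ?_, by simp [mul_pow, hε]⟩
      exact Module.End.hasEigenvalue_of_hasEigenvector
        ⟨Module.End.mem_eigenspace_iff.2 hv, hv0⟩
    · intro n _ k _ hnk
      have : (((2 * n + 1 : ℕ)) ^ 2 : ℂ) = ((2 * k + 1 : ℕ)) ^ 2 := by push_cast; exact hnk
      have := Nat.pow_left_injective (n := 2) (by norm_num) (by exact_mod_cast this)
      omega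
  obtain ⟨N, ⟨ε, hε, v, hv0, hv⟩, hmax⟩ := hfin.exists_maximal hne
  -- At the largest absolute value `2N + 1` the raising map must give zero, since its image would
  -- have eigenvalue `-ε(2N + 3)`. Its square then vanishes, which determines `ω`.
  have hω1 : ω = (2 * N + 2) ^ 2 - 1 := by
    have h1 := h.apply_sub_smul hε hv
    have h2 : B v - ε • C v = 0 := by
      by_contra h0
      have : N + 1 ∈ S := ⟨-ε, by simpa using hε, _, h0, by
        rw [h1]; congr 1; push_cast; ring⟩
      have := hmax this (by omega)
      omega
    have h3 := h.sq_sub_smul hε hω hv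
    rw [h2, map_zero, map_zero, smul_zero, sub_zero, eq_comm, smul_eq_zero] at h3
    have h4 := h3.resolve_right hv0
    linear_combination h4 + (2 * N + 1) ^ 2 * hε + 2 * (2 * N + 1) * hε
  have hmem := Nat.sInf_mem hne
  obtain ⟨η, hη, u, hu0, hu⟩ := hmem
  rcases Nat.eq_zero_or_pos (sInf S) with h0 | hpos
  · exact ⟨η, hη, u, hu0, by rw [hu, h0]; simp⟩
  obtain ⟨n, hn⟩ : ∃ n, sInf S = n + 1 := ⟨sInf S - 1, by omega⟩
  rw [hn] at hu
  exfalso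
  -- If the smallest absolute value were `2n + 3`, the lowering map would vanish there and force `ω
  -- = (2n + 2)² - 1` as well. Then `N = n`, below the minimum `n + 1`.
  have hη' : (-η) ^ 2 = 1 := by simpa using hη
  have h1 := h.apply_sub_smul hη' hu
  have h2 : B u - (-η) • C u = 0 := by
    by_contra h0
    have : n ∈ S := ⟨-η, hη', _, h0, by rw [h1]; congr 1; push_cast; ring⟩
    have := Nat.sInf_le this
    omega
  have h3 := h.sq_sub_smul hη' hω hu
  rw [h2, map_zero, map_zero, smul_zero, sub_zero, eq_comm, smul_eq_zero] at h3
  have h4 := h3.resolve_right hu0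
  have h5 : ((2 * N + 2 : ℕ) : ℂ) ^ 2 = ((2 * n + 2 : ℕ) : ℂ) ^ 2 := by
    push_cast at h4 ⊢
    linear_combination h4 - hω1 + ((2 * n + 3) ^ 2 - 2 * (2 * n + 3)) * hη
  have h6 := Nat.pow_left_injective (n := 2) (by norm_num) (by exact_mod_cast h5)
  have hNS : N ∈ S := ⟨ε, hε, v, hv0, hv⟩
  have := Nat.sInf_le hNS
  simp at h6
  omega

/-! ### The chain of eigenvectors and the basis it gives -/

/-- The chain of `A`-eigenvectors that starts at `v`. -/
noncomputable def chain (B C : Module.End ℂ V) (ε : ℂ) (v : V) : ℕ → V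
  | 0 => v
  | n + 1 => B (chain B C ε v n) - (ε * (-1) ^ n) • C (chain B C ε v n)

theorem sign_sq {ε : ℂ} (hε : ε ^ 2 = 1) (n : ℕ) : (ε * (-1) ^ n) ^ 2 = 1 := by
  rw [mul_pow, hε, ← pow_mul, mul_comm n, pow_mul]; simp

/-- With `η = ε(-1)^n`, the step sends the eigenvalue `η(2n + 1)` to `-2η - η(2n + 1) = -η(2n + 3)`;
the alternating sign makes every step increase the absolute value. -/
theorem apply_chain (h : IsSpinTriple A B C) {ε : ℂ} (hε : ε ^ 2 = 1) {v : V}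
    (hv : A v = ε • v) (n : ℕ) :
    A (chain B C ε v n) = (ε * (-1) ^ n * (2 * n + 1)) • chain B C ε v n := by
  induction n with
  | zero => simpa [chain] using hv
  | succ n ih =>
    rw [chain, h.apply_sub_smul (sign_sq hε n) ih]
    congr 1
    push_cast
    ring

/-- The map that raises term `n` also lowers term `n + 1`, because its square is a scalar on the
eigenspace of term `n`. -/
theorem chain_down (h : IsSpinTriple A B C) {ε ω : ℂ} (hε : ε ^ 2 = 1)
    (hω : ∀ v, A (A v) + B (B v) + C (C v) = ω • v) {v : V}
    (hv : A v = ε • v) (n : ℕ) :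
    B (chain B C ε v (n + 1)) - (ε * (-1) ^ n) • C (chain B C ε v (n + 1)) =
      (ω + 1 - (2 * n + 2) ^ 2) • chain B C ε v n := by
  rw [chain, h.sq_sub_smul (sign_sq hε n) hω (h.apply_chain hε hv n)]
  congr 1
  linear_combination (-(2 * n + 1) ^ 2 - 2 * (2 * n + 1)) * sign_sq hε n

theorem signed_odd_injective {ε : ℂ} (hε : ε ^ 2 = 1) {i j : ℕ}
    (h : (ε * (-1) ^ i * (2 * i + 1)) ^ 2 = (ε * (-1) ^ j * (2 * j + 1)) ^ 2) : i = j := by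
  rw [mul_pow, mul_pow _ (2 * (j : ℂ) + 1), sign_sq hε, sign_sq hε, one_mul, one_mul] at h
  have h1 : ((2 * i + 1 : ℕ) : ℂ) ^ 2 = ((2 * j + 1 : ℕ) : ℂ) ^ 2 := by push_cast; exact h
  have h2 := Nat.pow_left_injective (n := 2) (by norm_num) (by exact_mod_cast h1)
  simp at h2
  omega

theorem exists_chain_eq_zero [FiniteDimensional ℂ V] (h : IsSpinTriple A B C) {ε : ℂ}
    (hε : ε ^ 2 = 1) {v : V} (hv : A v = ε • v) : ∃ n, chain B C ε v n = 0 := by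
  by_contra! hne
  have hA : {μ : ℂ | A.HasEigenvalue μ}.Finite := Module.End.finite_hasEigenvalue A
  refine Set.infinite_of_injective_forall_mem (f := fun n : ℕ => ε * (-1) ^ n * (2 * n + 1))
    (s := {μ : ℂ | A.HasEigenvalue μ}) (fun i j hij => ?_) (fun n => ?_) hA
  · exact signed_odd_injective hε (congrArg (· ^ 2) hij)
  · exact Module.End.hasEigenvalue_of_hasEigenvector
      ⟨Module.End.mem_eigenspace_iff.2 (h.apply_chain hε hv n), hne n⟩

/-- The component of `B (chain n)` along the preceding vector of the chain. -/
noncomputable def chainPred (B C : Module.End ℂ V) (ε ω m : ℂ) (v : V) : ℕ → V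
  | 0 => m • v
  | n + 1 => (ω + 1 - (2 * n + 2) ^ 2) • chain B C ε v n

/-- The sign alternates, so `B + ηC` at term `n + 1` is the raising map of term `n`, and
`chain_down` applies. At term `0` it preserves the eigenspace, and `hm` supplies its value. With the
definition of the next term this gives two linear equations, which determine `B` and `C` on the
chain. -/
theorem chain_pred (h : IsSpinTriple A B C) {ε ω m : ℂ} (hε : ε ^ 2 = 1)
    (hω : ∀ v, A (A v) + B (B v) + C (C v) = ω • v) {v : V}
    (hv : A v = ε • v) (hm : B v + ε • C v = m • v) (n : ℕ) :
    B (chain B C ε v n) + (ε * (-1) ^ n) • C (chain B C ε v n) =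
      chainPred B C ε ω m v n := by
  cases n with
  | zero => simpa [chain, chainPred] using hm
  | succ n =>
    rw [chainPred, ← h.chain_down hε hω hv n, pow_succ]
    module

theorem apply_chain_left (h : IsSpinTriple A B C) {ε ω m : ℂ} (hε : ε ^ 2 = 1)
    (hω : ∀ v, A (A v) + B (B v) + C (C v) = ω • v) {v : V}
    (hv : A v = ε • v) (hm : B v + ε • C v = m • v) (n : ℕ) :
    B (chain B C ε v n) =
      (1 / 2 : ℂ) • chain B C ε v (n + 1) + (1 / 2 : ℂ) • chainPred B C ε ω m v n := by
  rw [← h.chain_pred hε hω hv hm, chain]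
  module

theorem apply_chain_right (h : IsSpinTriple A B C) {ε ω m : ℂ} (hε : ε ^ 2 = 1)
    (hω : ∀ v, A (A v) + B (B v) + C (C v) = ω • v) {v : V}
    (hv : A v = ε • v) (hm : B v + ε • C v = m • v) (n : ℕ) :
    C (chain B C ε v n) = (-(ε * (-1) ^ n) / 2) • chain B C ε v (n + 1) +
      (ε * (-1) ^ n / 2) • chainPred B C ε ω m v n := by
  rw [← h.chain_pred hε hω hv hm, chain]
  have e := sign_sq hε n
  generalize ε * (-1) ^ n = η at e ⊢
  generalize C (chain B C ε v n) = c
  have : c = (η ^ 2) • c := by rw [e, one_smul]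
  refine this.trans ?_
  module

/-- The map `B + εC` preserves the `ε`-eigenspace of `A` and squares to `ω + 1 = m²` there. Hence
either `v` is an eigenvector for `-m`, or `(B + εC)v + mv` is one for `m`. -/
theorem exists_start (h : IsSpinTriple A B C) {ε ω : ℂ} (hε : ε ^ 2 = 1)
    (hω : ∀ v, A (A v) + B (B v) + C (C v) = ω • v) {v : V} (hv0 : v ≠ 0)
    (hv : A v = ε • v) : ∃ m : ℂ, m ^ 2 = ω + 1 ∧
      ∃ u ≠ 0, A u = ε • u ∧ B u + ε • C u = m • u := by
  obtain ⟨m, hm⟩ := IsAlgClosed.exists_pow_nat_eq (ω + 1) (n := 2) (by norm_num)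
  have hε' : (-ε) ^ 2 = 1 := by simpa using hε
  have h1 := h.apply_sub_smul hε' hv
  have h2 := h.sq_sub_smul hε' hω hv
  have e : ω - ε ^ 2 - 2 * -ε * ε = m ^ 2 := by rw [hm]; linear_combination hε
  rw [e] at h2
  simp only [neg_smul, sub_neg_eq_add] at h1 h2
  by_cases h0 : (B v + ε • C v) + m • v = 0
  · refine ⟨-m, by simpa using hm, v, hv0, hv, ?_⟩
    rw [eq_neg_of_add_eq_zero_left h0, neg_smul]
  · refine ⟨m, hm, _, h0, ?_, ?_⟩
    · rw [map_add, h1, map_smul, hv]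
      module
    · rw [map_add, map_add C, map_smul B, map_smul C]
      have : B (B v + ε • C v) + m • B v + ε • (C (B v + ε • C v) + m • C v) =
        (B (B v + ε • C v) + ε • C (B v + ε • C v)) + m • (B v + ε • C v) := by module
      rw [this, h2]
      module

/-- The data of a basis of `A`-eigenvectors with simple eigenvalues, on which `B` and `C` are
irreducible tridiagonal. -/
structure IsChainBasis {d : ℕ} (A B C : Module.End ℂ V) (w : Module.Basis (Fin (d + 1)) ℂ V)
    (μ : Fin (d + 1) → ℂ) : Prop where
  apply : ∀ j, A (w j) = μ j • w j
  injective : Function.Injective μ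
  unit_unique : ∀ i j, μ i ^ 2 = 1 → μ j ^ 2 = 1 → i = j
  left : IsIrreducibleTridiagonal (LinearMap.toMatrix w w B)
  right : IsIrreducibleTridiagonal (LinearMap.toMatrix w w C)
  trace : LinearMap.trace ℂ V B ≠ 0

-- The chain is finite because its nonzero terms have distinct eigenvalues. Its span is invariant
-- under the three maps, hence is everything by irreducibility.
open Classical in
theorem exists_isChainBasis [FiniteDimensional ℂ V] [Nontrivial V] (h : IsSpinTriple A B C)
    (hirr : IsIrreducibleTriple A B C) (hodd : HasOddEigenvalue A) :
    ∃ (d : ℕ) (w : Module.Basis (Fin (d + 1)) ℂ V) (μ : Fin (d + 1) → ℂ),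
      IsChainBasis A B C w μ := by
  obtain ⟨ω, hω⟩ := h.exists_casimir hirr
  obtain ⟨ε, hε, v, hv0, hv⟩ := h.exists_unit_eigenvector hω hodd
  obtain ⟨m, hm, u, hu0, hu, hmu⟩ := h.exists_start hε hω hv0 hv
  have hε0 : ε ≠ 0 := by rintro rfl; norm_num at hε
  set s : ℕ → V := chain B C ε u with hs
  have hex := h.exists_chain_eq_zero hε hu
  obtain ⟨d, hd⟩ : ∃ d, Nat.find hex = d + 1 := by
    refine ⟨Nat.find hex - 1, ?_⟩
    have : Nat.find hex ≠ 0 := fun h0 => hu0 ((Nat.find_eq_zero hex).1 h0)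
    omega
  have hsd : s (d + 1) = 0 := hd ▸ Nat.find_spec hex
  have hs0 : ∀ n ≤ d, s n ≠ 0 := fun n hn => Nat.find_min hex (by omega)
  -- The chain stops after term `d`, so the coefficient that brings term `d + 1` back to term `d`
  -- must vanish.
  have hω1 : ω + 1 = (2 * d + 2) ^ 2 := by
    have h1 := h.chain_down hε hω hu d
    rw [← hs, hsd, map_zero, map_zero, smul_zero, sub_zero, eq_comm, smul_eq_zero] at h1
    linear_combination h1.resolve_right (hs0 d le_rfl)
  have hsz : ∀ n, d < n → s n = 0 := fun n hn => by
    induction n, hn using Nat.le_induction with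
    | base => exact hsd
    | succ n _ ih => rw [hs] at *; simp [chain, ih]
  let μ : Fin (d + 1) → ℂ := fun j => ε * (-1) ^ (j : ℕ) * (2 * (j : ℕ) + 1)
  have hμ : Function.Injective μ := fun i j hij =>
    Fin.ext (signed_odd_injective hε (congrArg (· ^ 2) hij))
  have hli : LinearIndependent ℂ fun j : Fin (d + 1) => s j :=
    Module.End.eigenvectors_linearIndependent' A μ hμ _ fun j =>
      ⟨Module.End.mem_eigenspace_iff.2 (h.apply_chain hε hu j), hs0 _ (by omega)⟩
  have hmemr : ∀ n, s n ∈ Submodule.span ℂ (Set.range s) :=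
    fun n => Submodule.subset_span ⟨n, rfl⟩
  have hpred : ∀ n, chainPred B C ε ω m u n ∈ Submodule.span ℂ (Set.range s) := by
    rintro (_ | n)
    · exact Submodule.smul_mem _ _ (hmemr 0)
    · exact Submodule.smul_mem _ _ (hmemr n)
  have hinv : ∀ F : Module.End ℂ V, (∀ n, F (s n) ∈ Submodule.span ℂ (Set.range s)) →
      ∀ x ∈ Submodule.span ℂ (Set.range s), F x ∈ Submodule.span ℂ (Set.range s) := by
    intro F hF x hx
    refine Submodule.span_le (p := (Submodule.span ℂ (Set.range s)).comap F) |>.2 ?_ hx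
    rintro _ ⟨n, rfl⟩
    exact hF n
  have htop : Submodule.span ℂ (Set.range s) = ⊤ := by
    refine (hirr _ (hinv A fun n => ?_) (hinv B fun n => ?_) (hinv C fun n => ?_)).resolve_left ?_
    · rw [hs, h.apply_chain hε hu]
      exact Submodule.smul_mem _ _ (hmemr n)
    · rw [hs, h.apply_chain_left hε hω hu hmu]
      exact Submodule.add_mem _ (Submodule.smul_mem _ _ (hmemr (n + 1)))
        (Submodule.smul_mem _ _ (hpred n))
    · rw [hs, h.apply_chain_right hε hω hu hmu]
      exact Submodule.add_mem _ (Submodule.smul_mem _ _ (hmemr (n + 1)))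
        (Submodule.smul_mem _ _ (hpred n))
    · intro hbot
      have := hmemr 0
      rw [hbot, Submodule.mem_bot] at this
      exact hs0 0 (by omega) this
  have hspan : ⊤ ≤ Submodule.span ℂ (Set.range fun j : Fin (d + 1) => s j) := by
    rw [← htop, Submodule.span_le]
    rintro _ ⟨n, rfl⟩
    by_cases hn : n ≤ d
    · exact Submodule.subset_span ⟨⟨n, by omega⟩, rfl⟩
    · rw [hsz n (by omega)]
      exact Submodule.zero_mem _
  let w := Module.Basis.mk hli hspan
  have hw : ∀ j, w j = s j := fun j => Module.Basis.mk_apply hli hspan j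
  have hrepr : ∀ n (i : Fin (d + 1)), w.repr (s n) i = if n = i then 1 else 0 := by
    intro n i
    by_cases hn : n ≤ d
    · have := w.repr_self_apply ⟨n, by omega⟩ i
      rw [hw] at this
      simp only [this, Fin.ext_iff]
    · rw [hsz n (by omega), if_neg (by omega)]
      simp
  -- `B` and `C` differ only in the coefficients `κ` and `l`, so one computation covers both
  -- matrices.
  have hmat : ∀ (F : Module.End ℂ V) (κ l : ℕ → ℂ),
      (∀ n, F (s n) = κ n • s (n + 1) + l n • chainPred B C ε ω m u n) →
      ∀ i j : Fin (d + 1), LinearMap.toMatrix w w F i j =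
        κ j * (if (j : ℕ) + 1 = i then 1 else 0) + l j *
        (if (j : ℕ) = 0 then m * (if (i : ℕ) = 0 then 1 else 0) else
          (ω + 1 - (2 * j) ^ 2) * (if (i : ℕ) + 1 = j then 1 else 0)) := by
    intro F κ l hF i j
    rw [LinearMap.toMatrix_apply, hw, hF, map_add, map_smul, map_smul, Finsupp.add_apply,
      Finsupp.smul_apply, Finsupp.smul_apply, hrepr, smul_eq_mul, smul_eq_mul]
    congr 2
    rcases j with ⟨_ | j, hj⟩
    · have := hrepr 0 i
      rw [hs, chain] at this
      simp [chainPred, this, eq_comm]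
    · have := hrepr j i
      simp only [chainPred, map_smul, Finsupp.smul_apply, ← hs, this]
      simp only [smul_eq_mul, Nat.add_eq_zero_iff, one_ne_zero, and_false, if_false,
        Nat.add_right_cancel_iff, eq_comm (a := (i : ℕ))]
      push_cast
      ring
  have htri : ∀ (F : Module.End ℂ V) (κ l : ℕ → ℂ), (∀ n, κ n ≠ 0) → (∀ n, l n ≠ 0) →
      (∀ n, F (s n) = κ n • s (n + 1) + l n • chainPred B C ε ω m u n) →
      IsIrreducibleTridiagonal (LinearMap.toMatrix w w F) := by
    intro F κ l hκ hl hF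
    constructor
    · intro i j hij
      by_contra! hne
      apply hij
      rw [hmat F κ l hF, if_neg (by omega)]
      split_ifs <;> first | omega | simp
    · intro i j hij
      rw [hmat F κ l hF, hmat F κ l hF]
      constructor
      · rw [if_neg (by omega), if_neg (by omega), if_pos hij, mul_zero, zero_add, mul_one]
        refine mul_ne_zero (hl _) ?_
        -- The superdiagonal factor is `(2d + 2)² - (2j)²`, nonzero because `j ≤ d`.
        rw [hω1]
        intro h0
        have h1 : ((2 * d + 2 : ℕ) : ℂ) ^ 2 = ((2 * j : ℕ) : ℂ) ^ 2 := by
          push_cast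
          linear_combination h0
        have h2 := Nat.pow_left_injective (n := 2) (by norm_num) (by exact_mod_cast h1)
        omega
      · rw [if_pos hij]
        split_ifs <;> first | omega | simpa using hκ _
  refine ⟨d, w, μ, ⟨fun j => ?_, hμ, ?_, ?_, ?_, ?_⟩⟩
  · rw [hw]
    exact h.apply_chain hε hu j
  · intro i j hi hj
    exact Fin.ext (signed_odd_injective hε (hi.trans hj.symm))
  · exact htri B (fun _ => 1 / 2) (fun _ => 1 / 2) (by norm_num) (by norm_num)
      (h.apply_chain_left hε hω hu hmu)
  · exact htri C (fun n => -(ε * (-1) ^ n) / 2) (fun n => ε * (-1) ^ n / 2) (by simp [hε0])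
      (by simp [hε0]) (h.apply_chain_right hε hω hu hmu)
  -- The only diagonal entry of `B` that can be nonzero is the one at `0`, equal to `m / 2`; here
  -- `m² = (2d + 2)²`.
  · rw [LinearMap.trace_eq_matrix_trace ℂ w, Matrix.trace, Finset.sum_eq_single 0]
    · rw [Matrix.diag_apply, hmat B (fun _ => 1 / 2) (fun _ => 1 / 2)
        (h.apply_chain_left hε hω hu hmu)]
      have : m ≠ 0 := by
        rintro rfl
        rw [hω1] at hm
        have : ((2 * d + 2 : ℕ) : ℂ) ^ 2 = 0 := by push_cast; rw [← hm]; norm_num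
        have := pow_eq_zero_iff (two_ne_zero) |>.1 this
        norm_cast at this
      simpa using this
    · intro i _ hi
      have : (i : ℕ) ≠ 0 := fun h0 => hi (Fin.ext h0)
      rw [Matrix.diag_apply, hmat B (fun _ => 1 / 2) (fun _ => 1 / 2)
        (h.apply_chain_left hε hω hu hmu)]
      simp [this]
    · simp

/-! ### Arbitrary standard bases: eigenvalues and matrix entries -/

theorem isDiag_toMatrix_iff {d : ℕ} (b : Module.Basis (Fin (d + 1)) ℂ V) (A : Module.End ℂ V) :
    (LinearMap.toMatrix b b A).IsDiag ↔ ∃ θ : Fin (d + 1) → ℂ, ∀ i, A (b i) = θ i • b i := by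
  constructor
  · intro h
    refine ⟨fun i => LinearMap.toMatrix b b A i i, fun i => b.repr.injective ?_⟩
    ext j
    rw [← LinearMap.toMatrix_apply b b, map_smul, b.repr_self, Finsupp.smul_apply,
      Finsupp.single_apply]
    split_ifs with hij
    · subst hij
      simp
    · rw [h (Ne.symm hij)]
      simp
  · rintro ⟨θ, hθ⟩ i j hij
    rw [LinearMap.toMatrix_apply, hθ, map_smul, b.repr_self, Finsupp.smul_apply,
      Finsupp.single_eq_of_ne hij, smul_zero]

theorem IsChainBasis.isStandardBasis {d : ℕ} {w : Module.Basis (Fin (d + 1)) ℂ V}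
    {μ : Fin (d + 1) → ℂ} (hw : IsChainBasis A B C w μ) : IsStandardBasis w A B C :=
  ⟨(isDiag_toMatrix_iff w A).2 ⟨μ, hw.apply⟩, hw.left, hw.right⟩

/-- The spectrum is simple, so only one coordinate of an eigenvector can be nonzero. This carries
information from the chain basis to any other eigenbasis. -/
theorem IsChainBasis.eigenvector {d : ℕ} {w : Module.Basis (Fin (d + 1)) ℂ V}
    {μ : Fin (d + 1) → ℂ} (hw : IsChainBasis A B C w μ) {β : ℂ} {u : V} (hu0 : u ≠ 0)
    (hu : A u = β • u) : ∃ k, β = μ k ∧ ∃ c : ℂ, u = c • w k := by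
  have key : ∀ j, μ j * w.repr u j = β * w.repr u j := by
    intro j
    have h1 : w.repr (A u) j = β * w.repr u j := by rw [hu, map_smul]; rfl
    rw [← h1]
    conv_rhs => rw [← w.sum_repr u]
    simp only [map_sum, map_smul, hw.apply, Finsupp.coe_finsetSum, Finset.sum_apply,
      Finsupp.smul_apply, w.repr_self, smul_eq_mul, Finsupp.single_apply]
    simp [mul_comm]
  obtain ⟨k, hk⟩ : ∃ k, w.repr u k ≠ 0 := by
    by_contra! h0
    exact hu0 (w.repr.map_eq_zero_iff.1 (Finsupp.ext h0))
  have hβ : μ k = β := mul_right_cancel₀ hk (key k)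
  refine ⟨k, hβ.symm, w.repr u k, ?_⟩
  conv_lhs => rw [← w.sum_repr u]
  refine Finset.sum_eq_single k (fun j _ hj => ?_) (by simp)
  have : w.repr u j = 0 := by
    by_contra h0
    exact hj (hw.injective ((mul_right_cancel₀ h0 (key j)).trans hβ.symm))
  rw [this, zero_smul]

/-- The eigenvalues of the first map on a basis of eigenvectors are distinct, and at most one of
them is `±1`. -/
theorem IsChainBasis.eigenvalues {d e : ℕ} {w : Module.Basis (Fin (d + 1)) ℂ V}
    {μ : Fin (d + 1) → ℂ} (hw : IsChainBasis A B C w μ) (b : Module.Basis (Fin (e + 1)) ℂ V)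
    {θ : Fin (e + 1) → ℂ} (hθ : ∀ i, A (b i) = θ i • b i) :
    Function.Injective θ ∧ ∀ i j, θ i ^ 2 = 1 → θ j ^ 2 = 1 → i = j := by
  have hinj : Function.Injective θ := by
    intro i j hij
    obtain ⟨k, hk, c, hc⟩ := hw.eigenvector (b.ne_zero i) (hθ i)
    obtain ⟨l, hl, c', hc'⟩ := hw.eigenvector (b.ne_zero j) (hθ j)
    obtain rfl : k = l := hw.injective (by rw [← hk, ← hl, hij])
    by_contra hne
    have h1 : c' • b i = c • b j := by rw [hc, hc', smul_comm]
    have h2 := congrArg (fun v => b.repr v i) h1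
    simp [Ne.symm hne] at h2
    rw [h2, zero_smul] at hc'
    exact b.ne_zero j hc'
  refine ⟨hinj, fun i j hi hj => hinj ?_⟩
  obtain ⟨k, hk, -⟩ := hw.eigenvector (b.ne_zero i) (hθ i)
  obtain ⟨l, hl, -⟩ := hw.eigenvector (b.ne_zero j) (hθ j)
  rw [hk] at hi ⊢
  rw [hl] at hj ⊢
  rw [hw.unit_unique k l hi hj]

section entries

variable {d : ℕ} {b : Module.Basis (Fin (d + 1)) ℂ V} {θ : Fin (d + 1) → ℂ}

theorem toMatrix_right_eq (h : IsSpinTriple A B C) (hθ : ∀ i, A (b i) = θ i • b i)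
    (i j : Fin (d + 1)) :
    (θ i + θ j) * LinearMap.toMatrix b b B i j = 2 * LinearMap.toMatrix b b C i j := by
  have hA : LinearMap.toMatrix b b A = Matrix.diagonal θ := by
    ext i j
    rw [LinearMap.toMatrix_apply, hθ, map_smul, b.repr_self, Finsupp.smul_apply,
      Finsupp.single_apply, Matrix.diagonal_apply]
    split_ifs with h1 h2 h2
    · rw [h1]; simp
    · exact absurd h1.symm h2
    · exact absurd h2.symm h1
    · simp
  have h1 : A * B + B * A = (2 : ℂ) • C := LinearMap.ext h.ab
  have h2 := congrArg (fun F => LinearMap.toMatrix b b F i j) h1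
  simp only [map_add, LinearMap.toMatrix_mul, hA, map_smul, Matrix.add_apply,
    Matrix.diagonal_mul, Matrix.mul_diagonal, Matrix.smul_apply, smul_eq_mul] at h2
  rw [← h2]
  ring

/-- The relations for `AB + BA` and `CA + AC` give `(θ i + θ j) B i j = 2 C i j` and the same with
`B` and `C` exchanged; eliminate `C i j`. -/
theorem sq_eigenvalue_add (h : IsSpinTriple A B C) (hθ : ∀ i, A (b i) = θ i • b i)
    {i j : Fin (d + 1)} (hij : LinearMap.toMatrix b b B i j ≠ 0) : (θ i + θ j) ^ 2 = 4 := by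
  have h1 := h.toMatrix_right_eq hθ i j
  have h2 := h.swap.toMatrix_right_eq hθ i j
  refine mul_right_cancel₀ hij ?_
  linear_combination (θ i + θ j) * h1 + 2 * h2

/-- Consecutive sums of eigenvalues on a standard basis have opposite signs. -/
theorem eigenvalue_add_alternate (h : IsSpinTriple A B C) (hθ : ∀ i, A (b i) = θ i • b i)
    (hB : IsIrreducibleTridiagonal (LinearMap.toMatrix b b B))
    (hC : IsIrreducibleTridiagonal (LinearMap.toMatrix b b C))
    {i j k : Fin (d + 1)} (hij : (i : ℕ) + 1 = j) (hjk : (j : ℕ) + 1 = k) :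
    θ i + θ j = -(θ j + θ k) := by
  have h1 : B * C + C * B = (2 : ℂ) • A := LinearMap.ext h.bc
  have h2 := congrArg (fun F => LinearMap.toMatrix b b F i k) h1
  have hsum : ∀ M N : Matrix (Fin (d + 1)) (Fin (d + 1)) ℂ, IsIrreducibleTridiagonal M →
      -- Two steps apart, the only path from `i` to `k` passes through `j`. The `(i, k)` entry of
      -- `BC + CB = 2A` is zero, as `A` is diagonal.
      IsIrreducibleTridiagonal N → (M * N) i k = M i j * N j k := by
    intro M N hM hN
    rw [Matrix.mul_apply]
    refine Finset.sum_eq_single j (fun l _ hl => ?_) (by simp)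
    by_contra h0
    have h3 := hM.1 _ _ (left_ne_zero_of_mul h0)
    have h4 := hN.1 _ _ (right_ne_zero_of_mul h0)
    have := Fin.val_ne_of_ne hl
    omega
  simp only [map_add, LinearMap.toMatrix_mul, map_smul, Matrix.add_apply, Matrix.smul_apply,
    smul_eq_mul, hsum _ _ hB hC, hsum _ _ hC hB] at h2
  rw [LinearMap.toMatrix_apply b b A, hθ, map_smul, b.repr_self, Finsupp.smul_apply,
    Finsupp.single_eq_of_ne (by intro h0; rw [h0] at hij; omega), smul_zero, mul_zero] at h2
  have h3 := h.toMatrix_right_eq hθ i j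
  have h4 := h.toMatrix_right_eq hθ j k
  have h5 : LinearMap.toMatrix b b B i j * LinearMap.toMatrix b b B j k ≠ 0 :=
    mul_ne_zero (hB.2 i j hij).1 (hB.2 j k hjk).1
  refine mul_right_cancel₀ h5 ?_
  linear_combination LinearMap.toMatrix b b B j k * h3 + LinearMap.toMatrix b b B i j * h4 +
    2 * h2

/-- A nonzero diagonal entry forces `θ i = ±1`, so there is at most one, and the trace shows that
there is at least one. It cannot be interior: the sums of `θ i` with its two neighbours would be `2
θ i` and `-2 θ i` in some order, so one neighbour would repeat the eigenvalue `θ i`. -/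
theorem isAlmostBipartite (h : IsSpinTriple A B C) (hθ : ∀ i, A (b i) = θ i • b i)
    (hB : IsIrreducibleTridiagonal (LinearMap.toMatrix b b B))
    (hC : IsIrreducibleTridiagonal (LinearMap.toMatrix b b C))
    (hinj : Function.Injective θ) (huniq : ∀ i j, θ i ^ 2 = 1 → θ j ^ 2 = 1 → i = j)
    (htr : LinearMap.trace ℂ V B ≠ 0) : IsAlmostBipartite (LinearMap.toMatrix b b B) := by
  have hdiag : ∀ i, LinearMap.toMatrix b b B i i ≠ 0 → θ i ^ 2 = 1 := by
    intro i hi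
    linear_combination (1 / 4 : ℂ) * h.sq_eigenvalue_add hθ hi
  have hint : ∀ i : Fin (d + 1), i ≠ 0 → i ≠ Fin.last d → LinearMap.toMatrix b b B i i = 0 := by
    intro i h0 hd
    by_contra hne
    have hi := hdiag i hne
    have h0' : (i : ℕ) ≠ 0 := fun h => h0 (Fin.ext h)
    have hd' : (i : ℕ) ≠ d := fun h => hd (Fin.ext h)
    obtain ⟨p, hp⟩ : ∃ p : Fin (d + 1), (p : ℕ) + 1 = i :=
      ⟨⟨i - 1, by omega⟩, show (i : ℕ) - 1 + 1 = i by omega⟩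
    obtain ⟨q, hq⟩ : ∃ q : Fin (d + 1), (i : ℕ) + 1 = q := ⟨⟨i + 1, by omega⟩, rfl⟩
    have h1 := h.eigenvalue_add_alternate hθ hB hC hp hq
    have h2 := h.sq_eigenvalue_add hθ (hB.2 p i hp).1
    have h3 : (θ p + θ i - 2 * θ i) * (θ p + θ i + 2 * θ i) = 0 := by
      linear_combination h2 - 4 * hi
    rcases mul_eq_zero.1 h3 with h4 | h4
    · have : p = i := hinj (by linear_combination h4)
      rw [this] at hp
      omega
    · have : q = i := hinj (by linear_combination h1 - h4)
      rw [this] at hq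
      omega
  refine ⟨?_, hint⟩
  obtain ⟨i, hi⟩ : ∃ i, LinearMap.toMatrix b b B i i ≠ 0 := by
    by_contra! h0
    rw [LinearMap.trace_eq_matrix_trace ℂ b, Matrix.trace] at htr
    exact htr (Finset.sum_eq_zero fun i _ => h0 i)
  refine ⟨i, ⟨?_, hi⟩, fun j hj => huniq _ _ (hdiag j hj.2) (hdiag i hi)⟩
  by_contra! hne
  exact hi (hint i hne.1 hne.2)

theorem isBannaiIto_of_injective (h : IsSpinTriple A B C) (hθ : ∀ i, A (b i) = θ i • b i)
    (hB : IsIrreducibleTridiagonal (LinearMap.toMatrix b b B))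
    (hC : IsIrreducibleTridiagonal (LinearMap.toMatrix b b C))
    (hinj : Function.Injective θ) (i : ℕ) (hi : i + 3 < d + 1) :
    (θ ⟨i, by omega⟩ - θ ⟨i + 3, hi⟩) / (θ ⟨i + 1, by omega⟩ - θ ⟨i + 2, by omega⟩) = -1 := by
  have h1 := h.eigenvalue_add_alternate hθ hB hC (i := ⟨i, by omega⟩) (j := ⟨i + 1, by omega⟩)
    (k := ⟨i + 2, by omega⟩) rfl rfl
  have h2 := h.eigenvalue_add_alternate hθ hB hC (i := ⟨i + 1, by omega⟩)
    (j := ⟨i + 2, by omega⟩) (k := ⟨i + 3, hi⟩) rfl rfl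
  rw [div_eq_iff]
  · linear_combination h1 - h2
  · rw [sub_ne_zero]
    intro h0
    have := hinj h0
    simp at this

end entries

theorem almostBipartite_of_isStandardBasis [FiniteDimensional ℂ V] [Nontrivial V]
    (h : IsSpinTriple A B C) (hirr : IsIrreducibleTriple A B C) (hodd : HasOddEigenvalue A)
    {d : ℕ} {b : Module.Basis (Fin (d + 1)) ℂ V} (hb : IsStandardBasis b A B C) :
    IsAlmostBipartite (LinearMap.toMatrix b b B) ∧
      IsAlmostBipartite (LinearMap.toMatrix b b C) := by
  obtain ⟨θ, hθ⟩ := (isDiag_toMatrix_iff b A).1 hb.1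
  obtain ⟨e, w, μ, hw⟩ := h.exists_isChainBasis hirr hodd
  obtain ⟨e', w', μ', hw'⟩ := h.swap.exists_isChainBasis
    (fun U hA hC hB => hirr U hA hB hC) hodd
  obtain ⟨hinj, huniq⟩ := hw.eigenvalues b hθ
  exact ⟨h.isAlmostBipartite hθ hb.2.1 hb.2.2 hinj huniq hw.trace,
    h.swap.isAlmostBipartite hθ hb.2.2 hb.2.1 hinj huniq hw'.trace⟩

/-- An irreducible representation of the anticommutator spin algebra on which the three generators
have odd integer eigenvalues is a totally almost bipartite Leonard triple of Bannai/Ito type. -/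
theorem leonardTriple [FiniteDimensional ℂ V] [Nontrivial V]
    (h : IsSpinTriple A B C) (hirr : IsIrreducibleTriple A B C) (hA : HasOddEigenvalue A)
    (hB : HasOddEigenvalue B) (hC : HasOddEigenvalue C) :
    IsTotallyAlmostBipartiteLeonardTriple A B C ∧ IsBannaiItoType A B C := by
  have hirr1 : IsIrreducibleTriple B C A := fun U hB hC hA => hirr U hA hB hC
  have hirr2 : IsIrreducibleTriple C A B := fun U hC hA hB => hirr U hA hB hC
  obtain ⟨d, w, μ, hw⟩ := h.exists_isChainBasis hirr hA
  obtain ⟨d1, w1, μ1, hw1⟩ := h.rotate.exists_isChainBasis hirr1 hB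
  obtain ⟨d2, w2, μ2, hw2⟩ := h.rotate.rotate.exists_isChainBasis hirr2 hC
  have hd1 : d1 = d := by
    have := Module.finrank_eq_card_basis w1
    rw [Module.finrank_eq_card_basis w] at this
    simpa using this.symm
  have hd2 : d2 = d := by
    have := Module.finrank_eq_card_basis w2
    rw [Module.finrank_eq_card_basis w] at this
    simpa using this.symm
  subst hd1 hd2
  refine ⟨⟨⟨_, ⟨w, hw.isStandardBasis⟩, ⟨w1, hw1.isStandardBasis⟩, ⟨w2, hw2.isStandardBasis⟩⟩,
    fun e b => ⟨fun hb => h.almostBipartite_of_isStandardBasis hirr hA hb,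
      fun hb => h.rotate.almostBipartite_of_isStandardBasis hirr1 hB hb,
      fun hb => h.rotate.rotate.almostBipartite_of_isStandardBasis hirr2 hC hb⟩⟩, ?_⟩
  intro e b hb θ hθ i hi
  exact h.isBannaiIto_of_injective hθ hb.2.1 hb.2.2 (hw.eigenvalues b hθ).1 i hi

end IsSpinTriple

end SpinTriple

/-! ### Sums of commuting involutions -/

section CommutingInvolutions

theorem sum_mul_sum_add_sum_mul_sum {ι R : Type*} [Fintype ι] [Ring R] (P Q S : ι → R)
    (hdiag : ∀ i, P i * Q i + Q i * P i = 2 * S i)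
    (hoff : ∀ i j, i ≠ j → P i * Q j + Q j * P i = 0) :
    (∑ i, P i) * (∑ i, Q i) + (∑ i, Q i) * (∑ i, P i) = 2 * ∑ i, S i := by
  rw [Finset.sum_mul_sum, Finset.sum_mul_sum, Finset.sum_comm (s := Finset.univ)
    (f := fun i j => Q i * P j), ← Finset.sum_add_distrib, Finset.mul_sum]
  refine Finset.sum_congr rfl fun i _ => ?_
  rw [← Finset.sum_add_distrib, Finset.sum_eq_single i, hdiag]
  · exact fun j _ hj => hoff i j hj.symm
  · simp

variable {ι V : Type*} [AddCommGroup V] [Module ℂ V]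

/-- The eigenvalues of a sum of `n` commuting involutions are of the form `n - 2 k`. -/
theorem eigenvalue_sum_involutions (X : ι → Module.End ℂ V)
    (hcomm : ∀ i j v, X i (X j v) = X j (X i v)) (hsq : ∀ i v, X i (X i v) = v)
    (s : Finset ι) : ∀ {β : ℂ} {v : V}, v ≠ 0 → ∑ i ∈ s, X i v = β • v →
      ∃ k : ℕ, β = s.card - 2 * k := by
  classical
  induction s using Finset.induction_on with
  | empty =>
    intro β v hv0 hv
    rw [Finset.sum_empty, eq_comm, smul_eq_zero] at hv
    exact ⟨0, by simpa using hv.resolve_right hv0⟩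
  | insert a s ha ih =>
    intro β v hv0 hv
    rw [Finset.sum_insert ha] at hv
    have hXv : ∑ i ∈ s, X i (X a v) = β • X a v - v := by
      have := congrArg (X a) hv
      rw [map_add, hsq, map_sum, map_smul] at this
      rw [← this, Finset.sum_congr rfl fun i _ => hcomm i a v]
      abel
    have hv' : ∑ i ∈ s, X i v = β • v - X a v := by rw [← hv]; abel
    rw [Finset.card_insert_of_notMem ha]
    -- If `v + X a v` is nonzero, it is fixed by `X a` and is an eigenvector of the remaining sum
    -- for `β - 1`. Otherwise `X a v = -v`, and `v` itself serves with `β + 1`.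
    by_cases h0 : v + X a v = 0
    · have h1 : X a v = -v := eq_neg_of_add_eq_zero_right h0
      obtain ⟨k, hk⟩ := ih (β := β + 1) hv0 (by rw [hv', h1]; module)
      exact ⟨k + 1, by push_cast; linear_combination hk⟩
    · obtain ⟨k, hk⟩ := ih (β := β - 1) h0 (by
        simp only [map_add, Finset.sum_add_distrib, hv', hXv]
        module)
      exact ⟨k, by push_cast; linear_combination hk⟩

theorem hasOddEigenvalue_restrict [Fintype ι] [FiniteDimensional ℂ V] (X : ι → Module.End ℂ V)
    (hcomm : ∀ i j v, X i (X j v) = X j (X i v)) (hsq : ∀ i v, X i (X i v) = v)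
    (hodd : Odd (Fintype.card ι)) {A : Module.End ℂ V} (hA : ∀ v, A v = ∑ i, X i v)
    {W : Submodule ℂ V} (hW : W ≠ ⊥) (hAW : ∀ w ∈ W, A w ∈ W) :
    HasOddEigenvalue (A.restrict hAW) := by
  have : Nontrivial W := Submodule.nontrivial_iff_ne_bot.2 hW
  obtain ⟨β, hβ⟩ := Module.End.exists_eigenvalue (A.restrict hAW)
  obtain ⟨v, hv⟩ := hβ.exists_hasEigenvector
  have hv1 := hv.apply_eq_smul
  have hv0 : (v : V) ≠ 0 := fun h => hv.2 (Subtype.ext h)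
  obtain ⟨k, hk⟩ := eigenvalue_sum_involutions X hcomm hsq Finset.univ (β := β) hv0 (by
    rw [← hA]
    exact congrArg Subtype.val hv1)
  obtain ⟨q, hq⟩ := hodd
  rw [Finset.card_univ, hq] at hk
  -- The eigenvalue is `2(q - k) + 1`, written as a sign times a positive odd integer.
  rcases le_or_gt k q with hkq | hkq
  · obtain ⟨n, rfl⟩ := Nat.exists_eq_add_of_le hkq
    refine ⟨n, 1, by norm_num, v, hv.2, ?_⟩
    rw [hv1, hk]
    congr 1
    push_cast
    ring
  · obtain ⟨n, rfl⟩ := Nat.exists_eq_add_of_lt hkq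
    refine ⟨n, -1, by norm_num, v, hv.2, ?_⟩
    rw [hv1, hk]
    congr 1
    push_cast
    ring

end CommutingInvolutions

/-! ### Coordinate flips and adjacency in the antipodal quotient -/

namespace AntipodalVertex

variable {D : ℕ}

theorem mk_eq_mk_iff {y z : Fin D → Bool} : mk y = mk z ↔ y = z ∨ antipode y = z :=
  ⟨fun h => Quotient.exact h, fun h => Quotient.sound h⟩

theorem antipode_injective : Function.Injective (antipode (D := D)) :=
  Function.LeftInverse.injective antipode_antipode

theorem mk_antipode (y : Fin D → Bool) : mk (antipode y) = mk y :=
  mk_eq_mk_iff.2 (Or.inr (antipode_antipode y))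

theorem exists_rep (u : AntipodalVertex D) : ∃ y, mk y = u := Quotient.exists_rep u

/-- The vertex of the cube with the `i`-th coordinate changed. -/
def flipCoord (i : Fin D) (y : Fin D → Bool) : Fin D → Bool := Function.update y i (!y i)

theorem flipCoord_antipode (i : Fin D) (y : Fin D → Bool) :
    flipCoord i (antipode y) = antipode (flipCoord i y) := by
  funext j
  by_cases h : j = i
  · subst h; simp [flipCoord, antipode]
  · simp [flipCoord, antipode, h]

theorem flipCoord_flipCoord (i : Fin D) (y : Fin D → Bool) : flipCoord i (flipCoord i y) = y := by
  simp [flipCoord]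

theorem flipCoord_comm (i j : Fin D) (y : Fin D → Bool) :
    flipCoord i (flipCoord j y) = flipCoord j (flipCoord i y) := by
  rcases eq_or_ne i j with rfl | h
  · rfl
  · simp [flipCoord, Function.update_of_ne h, Function.update_of_ne h.symm,
      Function.update_comm h]

/-- The class of the vertices with the `i`-th coordinate changed. -/
def flip (i : Fin D) (u : AntipodalVertex D) : AntipodalVertex D :=
  Quotient.liftOn u (fun y => mk (flipCoord i y)) fun y z h => by
    rcases h with rfl | rfl
    · rfl
    · rw [flipCoord_antipode, mk_antipode]

@[simp] theorem flip_mk (i : Fin D) (y : Fin D → Bool) : flip i (mk y) = mk (flipCoord i y) := rfl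

theorem flip_flip (i : Fin D) (u : AntipodalVertex D) : flip i (flip i u) = u := by
  obtain ⟨y, rfl⟩ := u.exists_rep
  rw [flip_mk, flip_mk, flipCoord_flipCoord]

theorem flip_comm (i j : Fin D) (u : AntipodalVertex D) :
    flip i (flip j u) = flip j (flip i u) := by
  obtain ⟨y, rfl⟩ := u.exists_rep
  simp only [flip_mk, flipCoord_comm]

theorem hypercube_adj_iff {y z : Fin D → Bool} :
    (hypercube D).Adj y z ↔ ∃ i, z = flipCoord i y := by
  change hammingDist y z = 1 ↔ _
  constructor
  · intro h
    obtain ⟨i, hi⟩ := Finset.card_eq_one.1 h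
    refine ⟨i, funext fun j => ?_⟩
    have hj : y j ≠ z j ↔ j = i := by
      have := Finset.ext_iff.1 hi j
      simpa using this
    by_cases h : j = i
    · have := hj.2 h
      subst h
      simp only [flipCoord, Function.update_self]
      cases hy : y j <;> cases hz : z j <;> simp_all
    · have := not_not.1 (mt hj.1 h)
      simp [flipCoord, h, this]
  · rintro ⟨i, rfl⟩
    rw [hammingDist, Finset.card_eq_one]
    refine ⟨i, Finset.ext fun j => ?_⟩
    rw [Finset.mem_filter, Finset.mem_singleton]
    by_cases h : j = i
    · subst h; simp [flipCoord]
    · simp [flipCoord, h]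

theorem flip_ne (hD : 3 ≤ D) (i : Fin D) (u : AntipodalVertex D) : flip i u ≠ u := by
  obtain ⟨y, rfl⟩ := u.exists_rep
  rw [flip_mk, Ne, mk_eq_mk_iff]
  rintro (h | h)
  · have := congrFun h i
    simp [flipCoord] at this
  · obtain ⟨j, hj⟩ : ∃ j : Fin D, j ≠ i := by
      have : Nontrivial (Fin D) := Fin.nontrivial_iff_two_le.2 (by omega)
      exact exists_ne i
    have := congrFun h j
    simp [flipCoord, antipode, hj] at this

/-- Flips in distinct coordinates change at most two coordinates in all, so with `D ≥ 3` the results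
are not antipodal either. -/
theorem flip_injective (hD : 3 ≤ D) (u : AntipodalVertex D) :
    Function.Injective fun i => flip i u := by
  obtain ⟨y, rfl⟩ := u.exists_rep
  intro i j hij
  by_contra hne
  simp only [flip_mk, mk_eq_mk_iff] at hij
  rcases hij with h | h
  · have := congrFun h i
    simp [flipCoord, hne] at this
  · obtain ⟨k, hk⟩ : ∃ k : Fin D, k ∉ ({i, j} : Finset (Fin D)) := by
      by_contra! hall
      have h1 := Finset.card_le_card (fun k _ => hall k : Finset.univ ⊆ ({i, j} : Finset (Fin D)))
      have h2 := Finset.card_le_two (a := i) (b := j)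
      rw [Finset.card_univ, Fintype.card_fin] at h1
      omega
    simp only [Finset.mem_insert, Finset.mem_singleton, not_or] at hk
    have := congrFun h k
    simp [flipCoord, antipode, hk.1, hk.2] at this

theorem adj_iff (hD : 3 ≤ D) {u v : AntipodalVertex D} :
    (antipodalQuotient D).Adj u v ↔ ∃ i, v = flip i u := by
  constructor
  · rintro ⟨-, y, z, rfl, rfl, h⟩
    obtain ⟨i, rfl⟩ := hypercube_adj_iff.1 h
    exact ⟨i, rfl⟩
  · rintro ⟨i, rfl⟩
    obtain ⟨y, rfl⟩ := u.exists_rep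
    exact ⟨(flip_ne hD i _).symm, y, _, rfl, rfl, hypercube_adj_iff.2 ⟨i, rfl⟩⟩

theorem adjacency_mulVec (hD : 3 ≤ D) (f : AntipodalVertex D → ℂ) (u : AntipodalVertex D) :
    (quotientAdjacency D).mulVec f u = ∑ i, f (flip i u) := by
  have hN : (antipodalQuotient D).neighborFinset u = Finset.univ.image fun i => flip i u := by
    ext v
    simp [adj_iff hD, eq_comm]
  rw [quotientAdjacency, SimpleGraph.adjMatrix_mulVec_apply, hN,
    Finset.sum_image fun i _ j _ h => flip_injective hD u h]

theorem two_mul_card (hD : 0 < D) : 2 * Fintype.card (AntipodalVertex D) = 2 ^ D := by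
  have h1 := Finset.card_eq_sum_card_fiberwise (s := (Finset.univ : Finset (Fin D → Bool)))
    (t := Finset.univ) (f := mk) (by simp)
  rw [Finset.sum_congr rfl (g := fun _ => 2), Finset.sum_const, Finset.card_univ,
    Finset.card_univ] at h1
  · simp at h1
    rw [h1, mul_comm]
  · intro u _
    obtain ⟨y, rfl⟩ := u.exists_rep
    have hne : antipode y ≠ y := fun h => by
      have := congrFun h ⟨0, hD⟩
      simp [antipode] at this
    rw [← Finset.card_pair hne]
    congr 1
    ext z
    simp only [Finset.mem_filter, Finset.mem_univ, true_and, mk_eq_mk_iff, Finset.mem_insert,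
      Finset.mem_singleton]
    rw [or_comm, ← antipode_injective.eq_iff (a := antipode z), antipode_antipode]

/-! ### Characters of the quotient -/

/-- The sign of a coordinate. -/
noncomputable def coordSign (y : Fin D → Bool) (j : Fin D) : ℂ := if y j then -1 else 1

theorem coordSign_mul_self (y : Fin D → Bool) (j : Fin D) : coordSign y j * coordSign y j = 1 := by
  unfold coordSign; split_ifs <;> norm_num

theorem coordSign_antipode (y : Fin D → Bool) (j : Fin D) :
    coordSign (antipode y) j = -coordSign y j := by
  cases h : y j <;> simp [coordSign, antipode, h]

theorem coordSign_flipCoord (i : Fin D) (y : Fin D → Bool) (j : Fin D) :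
    coordSign (flipCoord i y) j = (if j = i then -1 else 1) * coordSign y j := by
  by_cases h : j = i
  · subst h
    cases h : y j <;> simp [coordSign, flipCoord, h]
  · simp [coordSign, flipCoord, h]

theorem coordSign_mul_eq (y z : Fin D → Bool) (j : Fin D) :
    coordSign y j * coordSign z j = if y j = z j then 1 else -1 := by
  cases hy : y j <;> cases hz : z j <;> simp [coordSign, hy, hz]

/-- The character of the cube for an (even) set of coordinates, as a function on the antipodal
quotient. -/
noncomputable def character (S : Finset (Fin D)) (u : AntipodalVertex D) : ℂ :=
  ∏ j ∈ S, coordSign (Quotient.out u) j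

/-- Passing to the antipode changes all `|S|` signs, so for even `S` the representative chosen by
`Quotient.out` is immaterial. -/
theorem character_mk {S : Finset (Fin D)} (hS : Even S.card) (y : Fin D → Bool) :
    character S (mk y) = ∏ j ∈ S, coordSign y j := by
  have : mk (Quotient.out (mk y)) = mk y := Quotient.out_eq _
  rw [character]
  generalize Quotient.out (mk y) = z at this ⊢
  rcases mk_eq_mk_iff.1 this with rfl | rfl
  · rfl
  · simp only [coordSign_antipode, Finset.prod_neg, hS.neg_one_pow, one_mul]

theorem character_mul_self (S : Finset (Fin D)) (u : AntipodalVertex D) :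
    character S u * character S u = 1 := by
  rw [character, ← Finset.prod_mul_distrib]
  exact Finset.prod_eq_one fun j _ => coordSign_mul_self _ _

theorem character_flip {S : Finset (Fin D)} (hS : Even S.card) (i : Fin D)
    (u : AntipodalVertex D) :
    character S (flip i u) = (if i ∈ S then -1 else 1) * character S u := by
  obtain ⟨y, rfl⟩ := u.exists_rep
  rw [flip_mk, character_mk hS, character_mk hS]
  simp only [coordSign_flipCoord, Finset.prod_mul_distrib, Finset.prod_ite_eq']

theorem even_card_compl_singleton (hodd : Odd D) (i : Fin D) :
    Even (({i}ᶜ : Finset (Fin D)).card) := by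
  rw [Finset.card_compl, Finset.card_singleton, Fintype.card_fin]
  exact Nat.Odd.sub_odd hodd odd_one

/-- Of the `D` flips, the `|S|` flips in `S` negate the character and the others fix it. -/
theorem adjacency_character (hD : 3 ≤ D) {S : Finset (Fin D)} (hS : Even S.card) :
    (quotientAdjacency D).mulVec (character S) = ((D : ℂ) - 2 * S.card) • character S := by
  funext u
  rw [adjacency_mulVec hD]
  simp only [character_flip hS, Pi.smul_apply, smul_eq_mul, ← Finset.sum_mul]
  congr 1
  rw [Finset.sum_ite, Finset.sum_const, Finset.sum_const, Finset.filter_univ_mem,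
    Finset.filter_not, Finset.filter_univ_mem, ← Finset.compl_eq_univ_sdiff, Finset.card_compl,
    Fintype.card_fin, nsmul_eq_mul, nsmul_eq_mul,
    Nat.cast_sub (by simpa using Finset.card_le_univ S)]
  ring

theorem prod_one_add_of_ne (c : ℂ) (hc : c ^ 2 = 1) (t : Fin D → ℂ) (ht : ∀ j, t j ^ 2 = 1)
    (h : ¬ ∀ j, t j = c) : ∏ j, (1 + c * t j) = 0 := by
  push Not at h
  obtain ⟨j, hj⟩ := h
  refine Finset.prod_eq_zero (Finset.mem_univ j) ?_
  have : (t j - c) * (t j + c) = 0 := by linear_combination ht j - hc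
  have h2 := (mul_eq_zero.1 this).resolve_left (sub_ne_zero.2 hj)
  linear_combination c * h2 - hc

/-- Orthogonality of the characters. -/
theorem sum_character_mul (hD : 0 < D) (u v : AntipodalVertex D) :
    ∑ S : Finset (Fin D) with Even S.card, character S u * character S v =
      if u = v then (Fintype.card (AntipodalVertex D) : ℂ) else 0 := by
  obtain ⟨y, rfl⟩ := u.exists_rep
  obtain ⟨z, rfl⟩ := v.exists_rep
  set t : Fin D → ℂ := fun j => coordSign y j * coordSign z j with ht
  have ht2 : ∀ j, t j ^ 2 = 1 := fun j => by
    rw [ht]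
    linear_combination coordSign z j * coordSign z j * coordSign_mul_self y j +
      coordSign_mul_self z j
  -- Averaging the expansions of `∏ (1 + t j)` and `∏ (1 - t j)` keeps exactly the subsets of even
  -- size.
  have h1 : ∑ S : Finset (Fin D) with Even S.card, character S (mk y) * character S (mk z) =
      1 / 2 * (∏ j, (1 + 1 * t j) + ∏ j, (1 + (-1) * t j)) := by
    rw [Finset.prod_one_add, Finset.prod_one_add, ← Finset.sum_add_distrib, Finset.mul_sum,
      Finset.powerset_univ, Finset.sum_filter]
    refine Finset.sum_congr rfl fun S _ => ?_
    have hc : ∀ c : ℂ, ∏ i ∈ S, c * t i = c ^ S.card * ∏ i ∈ S, t i := fun c => by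
      rw [Finset.prod_mul_distrib, Finset.prod_const]
    rw [hc, hc]
    split_ifs with hS
    · rw [character_mk hS, character_mk hS, hS.neg_one_pow, ht, Finset.prod_mul_distrib]
      ring
    · rw [(Nat.not_even_iff_odd.1 hS).neg_one_pow]
      ring
  have hcard : (Fintype.card (AntipodalVertex D) : ℂ) = 1 / 2 * 2 ^ D := by
    have := two_mul_card hD
    have : (2 * Fintype.card (AntipodalVertex D) : ℂ) = 2 ^ D := by exact_mod_cast this
    linear_combination this / 2
  have hpow : ∀ c : ℂ, c ^ 2 = 1 → (∀ j, t j = c) → ∏ j, (1 + c * t j) = 2 ^ D := by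
    intro c hc hj
    rw [Finset.prod_congr rfl (g := fun _ => 2), Finset.prod_const, Finset.card_univ,
      Fintype.card_fin]
    intro j _
    rw [hj]
    linear_combination hc
  have hyz : (∀ j, t j = 1) ↔ y = z := by
    rw [funext_iff]
    refine forall_congr' fun j => ?_
    simp only [ht, coordSign_mul_eq]
    split_ifs with h <;> norm_num [h]
  have hyz' : (∀ j, t j = -1) ↔ antipode y = z := by
    rw [funext_iff]
    refine forall_congr' fun j => ?_
    simp only [ht, coordSign_mul_eq, antipode]
    cases y j <;> cases z j <;> norm_num
  rw [h1, hcard]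
  have hc1 : (1 : ℂ) ^ 2 = 1 := by norm_num
  have hc2 : (-1 : ℂ) ^ 2 = 1 := by norm_num
  simp only [mk_eq_mk_iff]
  by_cases e1 : ∀ j, t j = 1
  · have e2 : ¬ ∀ j, t j = -1 := fun h => by
      have := (e1 ⟨0, hD⟩).symm.trans (h ⟨0, hD⟩)
      norm_num at this
    rw [if_pos (Or.inl (hyz.1 e1)), hpow 1 hc1 e1, prod_one_add_of_ne _ hc2 t ht2 e2, add_zero]
  · by_cases e2 : ∀ j, t j = -1
    · rw [if_pos (Or.inr (hyz'.1 e2)), hpow _ hc2 e2, prod_one_add_of_ne _ hc1 t ht2 e1, zero_add]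
    · rw [if_neg (by rw [← hyz, ← hyz']; tauto), prod_one_add_of_ne _ hc1 t ht2 e1,
        prod_one_add_of_ne _ hc2 t ht2 e2]
      ring

/-! ### Eigenvalues and the dual adjacency matrix -/

theorem eigenvalue_sq (D i : ℕ) : antipodalEigenvalue D i ^ 2 = ((D : ℂ) - 2 * i) ^ 2 := by
  rw [antipodalEigenvalue, mul_pow, ← pow_mul, mul_comm i, pow_mul]; simp

theorem eigenvalue_injOn :
    Set.InjOn (antipodalEigenvalue D) (Finset.range (D / 2 + 1)) := by
  intro i hi j hj hij
  simp only [Finset.coe_range, Set.mem_Iio] at hi hj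
  have h := congrArg (· ^ 2) hij
  simp only [eigenvalue_sq] at h
  have h1 : ((D - 2 * i : ℕ) : ℂ) ^ 2 = ((D - 2 * j : ℕ) : ℂ) ^ 2 := by
    rw [Nat.cast_sub (by omega), Nat.cast_sub (by omega)]
    push_cast
    exact h
  have h2 := Nat.pow_left_injective (n := 2) (by norm_num) (by exact_mod_cast h1)
  omega

/-- The eigenvalues in the form `D - 2 k` with even `k`. -/
theorem eigenvalue_eq_sub (hodd : Odd D) {k : ℕ} (hk : Even k) (hkD : k ≤ D) :
    (D : ℂ) - 2 * k = antipodalEigenvalue D (min k (D - k)) := by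
  rw [antipodalEigenvalue]
  rcases le_total k (D - k) with h | h
  · rw [min_eq_left h, hk.neg_one_pow, one_mul]
  · rw [min_eq_right h, (Nat.Odd.sub_even hkD hodd hk).neg_one_pow, Nat.cast_sub hkD]
    ring

/-- The index belonging to `D - 2k` is `min k (D - k)`. For even `k` it equals `1` only at `k = D -
1`, as `k = 1` is odd. -/
theorem lagrange_eval (hodd : Odd D) (hD : 3 ≤ D) {k : ℕ} (hk : Even k) (hkD : k ≤ D) :
    (Lagrange.basis (Finset.range (D / 2 + 1)) (antipodalEigenvalue D) 1).eval
      ((D : ℂ) - 2 * k) = if k = D - 1 then 1 else 0 := by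
  obtain ⟨q, hq⟩ := hodd
  obtain ⟨l, hl⟩ := hk
  rw [eigenvalue_eq_sub ⟨q, hq⟩ ⟨l, hl⟩ hkD]
  split_ifs with h
  · have : min k (D - k) = 1 := by omega
    rw [this]
    exact Lagrange.eval_basis_self eigenvalue_injOn (by simp; omega)
  · exact Lagrange.eval_basis_of_ne (by omega) (by simp; omega)

theorem sum_filter_card_pred (hD : 3 ≤ D) (hodd : Odd D) (f : Finset (Fin D) → ℂ) :
    (∑ S : Finset (Fin D) with Even S.card, if S.card = D - 1 then f S else 0) =
      ∑ i, f {i}ᶜ := by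
  have he : Even (D - 1) := Nat.Odd.sub_odd hodd odd_one
  rw [← Finset.sum_filter, Finset.filter_filter, ← Finset.sum_image (g := fun i => ({i}ᶜ : Finset (Fin D)))]
  · refine Finset.sum_congr ?_ fun _ _ => rfl
    ext S
    simp only [Finset.mem_filter, Finset.mem_univ, true_and, Finset.mem_image]
    constructor
    · rintro ⟨-, h⟩
      obtain ⟨i, hi⟩ := Finset.card_eq_one.1
        (show Sᶜ.card = 1 by rw [Finset.card_compl, h, Fintype.card_fin]; omega)
      exact ⟨i, by rw [← hi, compl_compl]⟩
    · rintro ⟨i, rfl⟩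
      rw [Finset.card_compl, Finset.card_singleton, Fintype.card_fin]
      exact ⟨he, rfl⟩
  · intro i _ j _ h
    simpa using h

theorem aeval_adjacency_character (hD : 3 ≤ D) (p : Polynomial ℂ) {S : Finset (Fin D)}
    (hS : Even S.card) :
    (Polynomial.aeval (quotientAdjacency D) p).mulVec (character S) =
      p.eval ((D : ℂ) - 2 * S.card) • character S := by
  have h0 : character S ≠ 0 := fun h => by
    have := character_mul_self S (mk fun _ => false)
    simp [h] at this
  have h := Module.End.aeval_apply_of_hasEigenvector (p := p)
    (f := Matrix.toLinAlgEquiv' (quotientAdjacency D)) (μ := (D : ℂ) - 2 * S.card)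
    (x := character S) ⟨Module.End.mem_eigenspace_iff.2 (adjacency_character hD hS), h0⟩
  rw [Polynomial.aeval_algHom_apply] at h
  exact h

/-- The entries of the dual adjacency matrix. -/
theorem dualAdjacency_eq (hodd : Odd D) (hD : 3 ≤ D) (u : AntipodalVertex D) :
    quotientDualAdjacency D u =
      Matrix.diagonal fun v => ∑ i : Fin D, character {i}ᶜ u * character {i}ᶜ v := by
  rw [quotientDualAdjacency, dualAdjacencyMatrix]
  congr 1
  funext v
  have hN : (Fintype.card (AntipodalVertex D) : ℂ) ≠ 0 := by
    have := two_mul_card (D := D) (by omega)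
    intro h
    rw [Nat.cast_eq_zero] at h
    rw [h, mul_zero] at this
    exact pow_ne_zero D two_ne_zero this.symm
  -- Expanding a point mass in characters lets `E₁` act by scalars: it keeps the characters of sets
  -- of size `D - 1` and kills the rest.
  have hsingle : (Fintype.card (AntipodalVertex D) : ℂ) • (Pi.single v 1 : AntipodalVertex D → ℂ) =
      ∑ S : Finset (Fin D) with Even S.card, character S v • character S := by
    funext w
    simp only [Pi.smul_apply, Finset.sum_apply, smul_eq_mul]
    rw [sum_character_mul (by omega)]
    simp [Pi.single_apply, eq_comm]
  have h1 : (Fintype.card (AntipodalVertex D) : ℂ) *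
      primitiveIdempotent (antipodalQuotient D) (D / 2) (antipodalEigenvalue D) 1 u v =
      (primitiveIdempotent (antipodalQuotient D) (D / 2) (antipodalEigenvalue D) 1).mulVec
        ((Fintype.card (AntipodalVertex D) : ℂ) • (Pi.single v 1 : AntipodalVertex D → ℂ)) u := by
    rw [Matrix.mulVec_smul, Matrix.mulVec_single_one]
    rfl
  rw [h1, hsingle, Matrix.mulVec_sum, Finset.sum_apply, ← sum_filter_card_pred hD hodd
    (fun S => character S u * character S v)]
  refine Finset.sum_congr rfl fun S hS => ?_
  have hS' : Even S.card := (Finset.mem_filter.1 hS).2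
  have h2 := aeval_adjacency_character hD
    (Lagrange.basis (Finset.range (D / 2 + 1)) (antipodalEigenvalue D) 1) hS'
  rw [lagrange_eval hodd hD hS' (by simpa using Finset.card_le_univ S)] at h2
  rw [Matrix.mulVec_smul, primitiveIdempotent]
  erw [h2]
  split_ifs
  · simp [mul_comm]
  · simp

/-! ### Distance in the quotient and the dual eigenvalues -/

theorem hammingDist_antipode (x y : Fin D → Bool) :
    hammingDist x (antipode y) = D - hammingDist x y := by
  have h := Finset.card_filter_add_card_filter_not (s := (Finset.univ : Finset (Fin D)))
    (fun i => x i ≠ y i)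
  rw [Finset.card_univ, Fintype.card_fin] at h
  have h2 : hammingDist x (antipode y) = (Finset.univ.filter fun i => ¬ x i ≠ y i).card := by
    rw [hammingDist]
    congr 1
    ext i
    rw [Finset.mem_filter, Finset.mem_filter]
    simp only [antipode, Finset.mem_univ, true_and]
    cases x i <;> cases y i <;> simp
  have h3 : hammingDist x y = (Finset.univ.filter fun i => x i ≠ y i).card := rfl
  omega

theorem hammingDist_flipCoord (x y : Fin D → Bool) (i : Fin D) :
    (x i ≠ y i ∧ hammingDist x (flipCoord i y) + 1 = hammingDist x y) ∨
      (x i = y i ∧ hammingDist x (flipCoord i y) = hammingDist x y + 1) := by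
  have key : ∀ z w : Fin D → Bool, w = flipCoord i z → x i ≠ z i →
      hammingDist x w + 1 = hammingDist x z := by
    rintro z _ rfl h
    have : (Finset.univ.filter fun j => x j ≠ flipCoord i z j) =
        (Finset.univ.filter fun j => x j ≠ z j).erase i := by
      ext j
      rw [Finset.mem_erase, Finset.mem_filter, Finset.mem_filter]
      by_cases hj : j = i
      · subst hj
        simp only [flipCoord, Function.update_self]
        cases h1 : x j <;> cases h2 : z j <;> simp_all
      · simp [flipCoord, hj]
    rw [hammingDist, this, Finset.card_erase_add_one]
    · rfl
    · simpa using h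
  by_cases h : x i = y i
  · refine Or.inr ⟨h, (key (flipCoord i y) y (flipCoord_flipCoord i y).symm ?_).symm⟩
    rw [h]
    simp [flipCoord]
  · exact Or.inl ⟨h, key y _ rfl h⟩

/-- The distance in the antipodal quotient. -/
def quotientDist (x : Fin D → Bool) (u : AntipodalVertex D) : ℕ :=
  Quotient.liftOn u (fun y => min (hammingDist x y) (D - hammingDist x y)) fun y z h => by
    rcases h with rfl | rfl
    · rfl
    · have : hammingDist x y ≤ D := by simpa using hammingDist_le_card_fintype (x := x) (y := y)
      simp only [hammingDist_antipode]
      omega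

@[simp] theorem quotientDist_mk (x y : Fin D → Bool) :
    quotientDist x (mk y) = min (hammingDist x y) (D - hammingDist x y) := rfl

theorem quotientDist_flip_le (x : Fin D → Bool) (i : Fin D) (u : AntipodalVertex D) :
    quotientDist x (flip i u) ≤ quotientDist x u + 1 := by
  obtain ⟨y, rfl⟩ := u.exists_rep
  rw [flip_mk, quotientDist_mk, quotientDist_mk]
  rcases hammingDist_flipCoord x y i with ⟨-, h⟩ | ⟨-, h⟩ <;> omega

/-- Move towards whichever of `x` and its antipode is nearer: flip a coordinate of disagreement in
the first case, of agreement in the second. -/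
theorem exists_quotientDist_flip (hodd : Odd D) (x : Fin D → Bool) (u : AntipodalVertex D)
    {n : ℕ} (hu : quotientDist x u = n + 1) : ∃ i, quotientDist x (flip i u) = n := by
  obtain ⟨q, hq⟩ := hodd
  obtain ⟨y, rfl⟩ := u.exists_rep
  rw [quotientDist_mk] at hu
  rcases le_total (hammingDist x y) (D - hammingDist x y) with h | h
  · obtain ⟨i, hi⟩ : ∃ i, x i ≠ y i := by
      by_contra! hall
      have : hammingDist x y = 0 := hammingDist_eq_zero.2 (funext hall)
      omega
    refine ⟨i, ?_⟩
    rw [flip_mk, quotientDist_mk]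
    rcases hammingDist_flipCoord x y i with ⟨-, h⟩ | ⟨h', -⟩
    · omega
    · exact absurd h' hi
  · obtain ⟨i, hi⟩ : ∃ i, x i = y i := by
      by_contra! hall
      have : antipode x = y := funext fun i => by
        have := hall i
        simp only [antipode]
        cases hx : x i <;> cases hy : y i <;> simp_all
      have := (eq_antipode_iff x y).1 this.symm
      omega
    refine ⟨i, ?_⟩
    rw [flip_mk, quotientDist_mk]
    rcases hammingDist_flipCoord x y i with ⟨h', -⟩ | ⟨-, h⟩
    · exact absurd hi h'
    · omega

theorem quotientDist_le (x : Fin D → Bool) (u : AntipodalVertex D) :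
    quotientDist x u ≤ D / 2 := by
  obtain ⟨y, rfl⟩ := u.exists_rep
  rw [quotientDist_mk]
  omega

theorem eq_of_quotientDist_eq_zero (x : Fin D → Bool) (u : AntipodalVertex D)
    (h : quotientDist x u = 0) : u = mk x := by
  obtain ⟨y, rfl⟩ := u.exists_rep
  have hle : hammingDist x y ≤ D := by simpa using hammingDist_le_card_fintype (x := x) (y := y)
  rw [quotientDist_mk] at h
  rw [eq_comm, mk_eq_mk_iff]
  rcases (by omega : hammingDist x y = 0 ∨ hammingDist x y = D) with h | h
  · exact Or.inl (hammingDist_eq_zero.1 h)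
  · exact Or.inr ((eq_antipode_iff x y).2 h).symm

/-- Descending by flips produces a walk of length `quotientDist`; no walk is shorter because
`quotientDist` grows by at most one along an edge. -/
theorem dist_eq (hodd : Odd D) (hD : 3 ≤ D) (x : Fin D → Bool) (u : AntipodalVertex D) :
    (antipodalQuotient D).dist (mk x) u = quotientDist x u := by
  have hwalk : ∀ n (v : AntipodalVertex D), quotientDist x v = n →
      ∃ p : (antipodalQuotient D).Walk (mk x) v, p.length = n := by
    intro n
    induction n with
    | zero =>
      intro v hv
      rw [eq_of_quotientDist_eq_zero x v hv]
      exact ⟨.nil, rfl⟩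
    | succ n ih =>
      intro v hv
      obtain ⟨i, hi⟩ := exists_quotientDist_flip hodd x v hv
      obtain ⟨p, hp⟩ := ih _ hi
      refine ⟨p.concat ((adj_iff hD).2 ⟨i, (flip_flip i v).symm⟩), ?_⟩
      rw [SimpleGraph.Walk.length_concat, hp]
  have hle : ∀ (v w : AntipodalVertex D) (p : (antipodalQuotient D).Walk v w),
      quotientDist x w ≤ quotientDist x v + p.length := by
    intro v w p
    induction p with
    | nil => simp
    | @cons a b c hadj p ih =>
      obtain ⟨i, rfl⟩ := (adj_iff hD).1 hadj
      have := quotientDist_flip_le x i a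
      rw [SimpleGraph.Walk.length_cons]
      omega
  obtain ⟨p, hp⟩ := hwalk _ u rfl
  refine le_antisymm (hp ▸ SimpleGraph.dist_le p) ?_
  obtain ⟨q, hq⟩ := p.reachable.exists_walk_length_eq_dist
  have h0 : quotientDist x (mk x) = 0 := by simp
  have := hle _ _ q
  omega

/-- The dual eigenvalues in terms of the distance. -/
theorem sum_character_eq (hodd : Odd D) (x : Fin D → Bool) (u : AntipodalVertex D) :
    ∑ i : Fin D, character {i}ᶜ (mk x) * character {i}ᶜ u =
      antipodalEigenvalue D (quotientDist x u) := by
  obtain ⟨y, rfl⟩ := u.exists_rep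
  have heven := even_card_compl_singleton hodd
  set t : Fin D → ℂ := fun j => if x j = y j then 1 else -1 with ht
  have ht2 : ∀ j, t j * t j = 1 := fun j => by
    simp only [ht]; split_ifs <;> norm_num
  -- Since `t i` squares to `1`, omitting it from the full product amounts to multiplying by it. The
  -- sum therefore factors as `(∏ t j) * ∑ t j`.
  have h1 : ∀ i : Fin D, character {i}ᶜ (mk x) * character {i}ᶜ (mk y) = (∏ j, t j) * t i := by
    intro i
    rw [character_mk (heven i), character_mk (heven i), ← Finset.prod_mul_distrib,
      ← Finset.prod_compl_mul_prod ({i} : Finset (Fin D)) t, Finset.prod_singleton, mul_assoc, ht2,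
      mul_one]
    exact Finset.prod_congr rfl fun j _ => coordSign_mul_eq x y j
  have hle : hammingDist x y ≤ D := by simpa using hammingDist_le_card_fintype (x := x) (y := y)
  have hne : (Finset.univ.filter fun j => ¬ x j = y j).card = hammingDist x y := rfl
  have heq : (Finset.univ.filter fun j => x j = y j).card + hammingDist x y = D := by
    rw [← hne, Finset.card_filter_add_card_filter_not]
    simp
  have hprod : ∏ j, t j = (-1) ^ hammingDist x y := by
    simp only [ht]
    rw [Finset.prod_ite, Finset.prod_const, Finset.prod_const, one_pow, one_mul, hne]
  have hsum : ∑ j, t j = (D : ℂ) - 2 * hammingDist x y := by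
    simp only [ht]
    rw [Finset.sum_ite, Finset.sum_const, Finset.sum_const, hne, nsmul_eq_mul, nsmul_eq_mul]
    have : (((Finset.univ.filter fun j => x j = y j).card : ℂ)) + hammingDist x y = D := by
      exact_mod_cast heq
    linear_combination this
  rw [Finset.sum_congr rfl fun i _ => h1 i, ← Finset.mul_sum, hprod, hsum, quotientDist_mk,
    antipodalEigenvalue]
  -- Replacing the Hamming distance `h` by `D - h` negates both `(-1)^h` (as `D` is odd) and `D -
  -- 2h`, so the product is unchanged.
  rcases le_total (hammingDist x y) (D - hammingDist x y) with h | h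
  · rw [min_eq_left h]
  · rw [min_eq_right h, Nat.cast_sub hle]
    rcases Nat.even_or_odd (hammingDist x y) with he | ho
    · rw [he.neg_one_pow, (Nat.Odd.sub_even hle hodd he).neg_one_pow]
      ring
    · rw [ho.neg_one_pow, (Nat.Odd.sub_odd hodd ho).neg_one_pow]
      ring

/-! ### Generating the Terwilliger algebra by the two adjacency matrices -/

theorem dualAdjacency_eq_diagonal (hodd : Odd D) (hD : 3 ≤ D) (x : Fin D → Bool) :
    quotientDualAdjacency D (mk x) =
      Matrix.diagonal fun v => antipodalEigenvalue D (quotientDist x v) := by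
  rw [dualAdjacency_eq hodd hD]
  simp only [sum_character_eq hodd]

/-- The diagonal entries of `B` at different distances are distinct, so Lagrange interpolation in
`B` isolates each distance; beyond `D / 2` the idempotent is zero. -/
theorem dualIdempotent_mem (hodd : Odd D) (hD : 3 ≤ D) (x : Fin D → Bool) (i : ℕ) :
    dualIdempotent (antipodalQuotient D) (mk x) i ∈
      Algebra.adjoin ℂ {quotientDualAdjacency D (mk x)} := by
  by_cases hi : i ≤ D / 2
  · have : dualIdempotent (antipodalQuotient D) (mk x) i =
        Polynomial.aeval (quotientDualAdjacency D (mk x))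
          (Lagrange.basis (Finset.range (D / 2 + 1)) (antipodalEigenvalue D) i) := by
      rw [dualAdjacency_eq_diagonal hodd hD, ← Matrix.diagonalAlgHom_apply ℂ,
        Polynomial.aeval_algHom_apply, Matrix.diagonalAlgHom_apply, dualIdempotent]
      congr 1
      funext v
      rw [Polynomial.aeval_fn_apply, dist_eq hodd hD, Polynomial.coe_aeval_eq_eval]
      have hv := quotientDist_le x v
      split_ifs with h
      · rw [h, Lagrange.eval_basis_self eigenvalue_injOn (by simp; omega)]
      · rw [Lagrange.eval_basis_of_ne (Ne.symm h) (by simp; omega)]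
    rw [this]
    exact Polynomial.aeval_mem_adjoin_singleton ℂ _
  · have : dualIdempotent (antipodalQuotient D) (mk x) i = 0 := by
      rw [dualIdempotent, ← Matrix.diagonal_zero]
      congr 1
      funext v
      have hv := quotientDist_le x v
      rw [dist_eq hodd hD, if_neg (by omega)]
    rw [this]
    exact Subalgebra.zero_mem _

theorem dualAdjacency_mem (hodd : Odd D) (hD : 3 ≤ D) (x : Fin D → Bool) :
    quotientDualAdjacency D (mk x) ∈ quotientTerwilliger D (mk x) := by
  have : quotientDualAdjacency D (mk x) = ∑ i ∈ Finset.range (D / 2 + 1),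
      antipodalEigenvalue D i • dualIdempotent (antipodalQuotient D) (mk x) i := by
    ext u v
    rw [dualAdjacency_eq_diagonal hodd hD, Matrix.sum_apply]
    simp only [Matrix.smul_apply, dualIdempotent, Matrix.diagonal_apply, dist_eq hodd hD]
    split_ifs with h
    · have hu := quotientDist_le x u
      rw [Finset.sum_eq_single (quotientDist x u)]
      · simp
      · intro j _ hj
        simp [Ne.symm hj]
      · intro h
        simp at h
        omega
    · simp
  rw [this]
  refine Subalgebra.sum_mem _ fun i _ => Subalgebra.smul_mem _ ?_ _
  exact (le_sup_right : dualBoseMesnerAlgebra (antipodalQuotient D) (mk x) ≤ _)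
    (Algebra.subset_adjoin ⟨i, rfl⟩)

theorem adjacency_mem (x : Fin D → Bool) :
    quotientAdjacency D ∈ quotientTerwilliger D (mk x) :=
  (le_sup_left : boseMesnerAlgebra (antipodalQuotient D) ≤ _) (Algebra.subset_adjoin rfl)

/-- A subspace that is invariant under the adjacency matrix and the dual adjacency matrix is a
module for the Terwilliger algebra. -/
theorem isMatrixSubmodule_of_invariant (hodd : Odd D) (hD : 3 ≤ D) (x : Fin D → Bool)
    (U : Submodule ℂ (AntipodalVertex D → ℂ))
    (hA : ∀ w ∈ U, (quotientAdjacency D).mulVec w ∈ U)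
    (hB : ∀ w ∈ U, (quotientDualAdjacency D (mk x)).mulVec w ∈ U) :
    IsMatrixSubmodule (quotientTerwilliger D (mk x)) U := by
  -- The matrices that preserve `U` form a subalgebra, so it suffices to test generators.
  let T : Subalgebra ℂ (Matrix (AntipodalVertex D) (AntipodalVertex D) ℂ) :=
    { carrier := {N | ∀ w ∈ U, N.mulVec w ∈ U}
      mul_mem' := fun {M N} hM hN w hw => by
        rw [← Matrix.mulVec_mulVec]
        exact hM _ (hN w hw)
      add_mem' := fun {M N} hM hN w hw => by
        rw [Matrix.add_mulVec]
        exact U.add_mem (hM w hw) (hN w hw)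
      algebraMap_mem' := fun r w hw => by
        rw [Algebra.algebraMap_eq_smul_one, Matrix.smul_mulVec, Matrix.one_mulVec]
        exact U.smul_mem r hw }
  have hT : quotientTerwilliger D (mk x) ≤ T := by
    refine sup_le (Algebra.adjoin_le ?_) (Algebra.adjoin_le ?_)
    · rintro _ rfl
      exact hA
    · rintro _ ⟨i, rfl⟩
      refine (Algebra.adjoin_le (S := T) ?_) (dualIdempotent_mem hodd hD x i)
      rintro _ rfl
      exact hB
  exact fun N hN => hT hN

end AntipodalVertex

/-! ### Spin families and the three relations -/

section SpinFamily

/-- Two families of commuting involutions such that members with the same index commute and members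
with different indices anticommute. -/
structure IsSpinFamily {ι R : Type*} [Ring R] (X Y : ι → R) : Prop where
  left_sq : ∀ i, X i * X i = 1
  right_sq : ∀ i, Y i * Y i = 1
  left_comm : ∀ i j, X i * X j = X j * X i
  right_comm : ∀ i j, Y i * Y j = Y j * Y i
  comm : ∀ i, X i * Y i = Y i * X i
  anticomm : ∀ i j, i ≠ j → X i * Y j + Y j * X i = 0

namespace IsSpinFamily

variable {ι R : Type*} [Ring R] {X Y : ι → R}

theorem mixed_sq (h : IsSpinFamily X Y) (i : ι) : (X i * Y i) * (X i * Y i) = 1 := by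
  rw [mul_assoc, ← mul_assoc (Y i), ← h.comm, mul_assoc (X i), h.right_sq, mul_one, h.left_sq]

/-- For distinct indices two anticommutations are needed, and their signs cancel. -/
theorem mixed_comm (h : IsSpinFamily X Y) (i j : ι) :
    (X i * Y i) * (X j * Y j) = (X j * Y j) * (X i * Y i) := by
  rcases eq_or_ne i j with rfl | hij
  · rfl
  have h1 := eq_neg_of_add_eq_zero_left (h.anticomm i j hij)
  have h2 := eq_neg_of_add_eq_zero_right (h.anticomm j i hij.symm)
  calc (X i * Y i) * (X j * Y j) = X i * (Y i * X j) * Y j := by simp only [mul_assoc]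
    _ = -((X i * X j) * (Y i * Y j)) := by rw [h2]; simp only [mul_assoc, mul_neg, neg_mul]
    _ = X j * -(X i * Y j) * Y i := by
        rw [h.left_comm, h.right_comm]; simp only [mul_assoc, mul_neg, neg_mul]
    _ = (X j * Y j) * (X i * Y i) := by rw [h1, neg_neg]; simp only [mul_assoc]

variable [Fintype ι]

theorem xy (h : IsSpinFamily X Y) :
    (∑ i, X i) * (∑ i, Y i) + (∑ i, Y i) * (∑ i, X i) = 2 * ∑ i, X i * Y i := by
  refine sum_mul_sum_add_sum_mul_sum _ _ _ (fun i => ?_) h.anticomm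
  rw [← h.comm, two_mul]

/-- A cross term is `(Y i * X j + X j * Y i) * Y j`, which vanishes; a diagonal term reduces by `Y i
* Y i = 1`. -/
theorem yz (h : IsSpinFamily X Y) :
    (∑ i, Y i) * (∑ i, X i * Y i) + (∑ i, X i * Y i) * (∑ i, Y i) = 2 * ∑ i, X i := by
  refine sum_mul_sum_add_sum_mul_sum _ _ _ (fun i => ?_) fun i j hij => ?_
  · rw [← mul_assoc, ← h.comm, mul_assoc, h.right_sq, mul_one, two_mul]
  · rw [← mul_assoc, mul_assoc (X j), h.right_comm j i, ← mul_assoc, ← add_mul, add_comm,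
      h.anticomm j i hij.symm, zero_mul]

theorem zx (h : IsSpinFamily X Y) :
    (∑ i, X i * Y i) * (∑ i, X i) + (∑ i, X i) * (∑ i, X i * Y i) = 2 * ∑ i, Y i := by
  refine sum_mul_sum_add_sum_mul_sum _ _ _ (fun i => ?_) fun i j hij => ?_
  · rw [mul_assoc, ← h.comm, ← mul_assoc, h.left_sq, one_mul, two_mul]
  · rw [← mul_assoc, ← h.left_comm i j, mul_assoc (X i) (X j), mul_assoc (X i), ← mul_add, add_comm,
      h.anticomm j i hij.symm, mul_zero]

end IsSpinFamily

end SpinFamily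

/-! ### The spin family on the standard module -/

namespace AntipodalVertex

variable {D : ℕ}

/-- Translation of functions along the `i`-th coordinate. -/
noncomputable def shift (i : Fin D) : Module.End ℂ (AntipodalVertex D → ℂ) :=
  LinearMap.funLeft ℂ ℂ (flip i)

/-- Multiplication by the product of the signs of all the coordinates except the `i`-th one,
relative to the vertex `u`. -/
noncomputable def dualShift (u : AntipodalVertex D) (i : Fin D) :
    Module.End ℂ (AntipodalVertex D → ℂ) :=
  LinearMap.mulLeft ℂ fun v => character {i}ᶜ u * character {i}ᶜ v

theorem shift_apply (i : Fin D) (f : AntipodalVertex D → ℂ) (v : AntipodalVertex D) :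
    shift i f v = f (flip i v) := rfl

theorem dualShift_apply (u : AntipodalVertex D) (i : Fin D) (f : AntipodalVertex D → ℂ)
    (v : AntipodalVertex D) :
    dualShift u i f v = character {i}ᶜ u * character {i}ᶜ v * f v := rfl

theorem shift_sq (i : Fin D) : shift i * shift i = 1 := by
  refine LinearMap.ext fun f => funext fun v => ?_
  simp [shift_apply, flip_flip]

theorem shift_comm (i j : Fin D) : shift i * shift j = shift j * shift i := by
  refine LinearMap.ext fun f => funext fun v => ?_
  simp [shift_apply, flip_comm]

theorem dualShift_sq (u : AntipodalVertex D) (i : Fin D) : dualShift u i * dualShift u i = 1 := by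
  refine LinearMap.ext fun f => funext fun v => ?_
  simp only [Module.End.mul_apply, dualShift_apply, Module.End.one_apply]
  linear_combination f v * character {i}ᶜ v * character {i}ᶜ v * character_mul_self {i}ᶜ u +
    f v * character_mul_self {i}ᶜ v

theorem dualShift_comm (u : AntipodalVertex D) (i j : Fin D) :
    dualShift u i * dualShift u j = dualShift u j * dualShift u i := by
  refine LinearMap.ext fun f => funext fun v => ?_
  simp only [Module.End.mul_apply, dualShift_apply]
  ring

theorem shift_mul_dualShift_self (hodd : Odd D) (u : AntipodalVertex D) (i : Fin D) :
    shift i * dualShift u i = dualShift u i * shift i := by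
  refine LinearMap.ext fun f => funext fun v => ?_
  simp [shift_apply, dualShift_apply, character_flip (even_card_compl_singleton hodd i)]

/-- For `i ≠ j` the coordinate `i` lies in the complement of `j`, so flipping it negates the
character. -/
theorem shift_mul_dualShift_of_ne (hodd : Odd D) (u : AntipodalVertex D) {i j : Fin D}
    (hij : i ≠ j) : shift i * dualShift u j + dualShift u j * shift i = 0 := by
  refine LinearMap.ext fun f => funext fun v => ?_
  simp [shift_apply, dualShift_apply, character_flip (even_card_compl_singleton hodd j), hij]

theorem isSpinFamily (hodd : Odd D) (u : AntipodalVertex D) : IsSpinFamily shift (dualShift u) :=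
  ⟨shift_sq, dualShift_sq u, shift_comm, dualShift_comm u, shift_mul_dualShift_self hodd u,
    fun _ _ => shift_mul_dualShift_of_ne hodd u⟩

theorem adjacency_mulVecLin (hD : 3 ≤ D) :
    (quotientAdjacency D).mulVecLin = ∑ i, shift i := by
  refine LinearMap.ext fun f => funext fun v => ?_
  rw [Matrix.mulVecLin_apply, adjacency_mulVec hD, LinearMap.sum_apply, Finset.sum_apply]
  rfl

theorem dualAdjacency_mulVecLin (hodd : Odd D) (hD : 3 ≤ D) (u : AntipodalVertex D) :
    (quotientDualAdjacency D u).mulVecLin = ∑ i, dualShift u i := by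
  refine LinearMap.ext fun f => funext fun v => ?_
  rw [Matrix.mulVecLin_apply, dualAdjacency_eq hodd hD, Matrix.mulVec_diagonal,
    LinearMap.sum_apply, Finset.sum_apply, Finset.sum_mul]
  rfl

/-- The third matrix, with the adjacency matrix and the dual adjacency matrix the generators of
the anticommutator spin algebra. -/
noncomputable def mixedAdjacency (u : AntipodalVertex D) :
    Matrix (AntipodalVertex D) (AntipodalVertex D) ℂ :=
  Matrix.toLinAlgEquiv'.symm (∑ i, shift i * dualShift u i)

theorem mixedAdjacency_mulVecLin (u : AntipodalVertex D) :
    (mixedAdjacency u).mulVecLin = ∑ i, shift i * dualShift u i :=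
  Matrix.toLinAlgEquiv'.apply_symm_apply _

theorem toLin_relation {P Q S : Matrix (AntipodalVertex D) (AntipodalVertex D) ℂ}
    (h : P.mulVecLin * Q.mulVecLin + Q.mulVecLin * P.mulVecLin = 2 * S.mulVecLin) :
    P * Q + Q * P = 2 * S := by
  apply Matrix.toLinAlgEquiv'.injective
  rw [map_add, map_mul, map_mul, map_mul, map_ofNat]
  exact h

end AntipodalVertex

/-! ### The representation and the irreducible modules -/

theorem spinAlgebra_xy : AnticommutatorSpinAlgebra.x ℂ * AnticommutatorSpinAlgebra.y ℂ +
    AnticommutatorSpinAlgebra.y ℂ * AnticommutatorSpinAlgebra.x ℂ =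
      (2 : ℂ) • AnticommutatorSpinAlgebra.z ℂ := by
  have h := RingQuot.mkAlgHom_rel ℂ (AnticommutatorSpinRel.xy (K := ℂ))
  rw [map_add, map_mul, map_mul, map_mul, map_ofNat, two_mul, ← two_smul ℂ] at h
  exact h

/-- A representation is determined by the action of the first two generators. -/
theorem spinAlgebra_hom_ext {R : Type*} [Ring R] [Algebra ℂ R]
    {ρ σ : AnticommutatorSpinAlgebra ℂ →ₐ[ℂ] R}
    (hx : ρ (AnticommutatorSpinAlgebra.x ℂ) = σ (AnticommutatorSpinAlgebra.x ℂ))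
    (hy : ρ (AnticommutatorSpinAlgebra.y ℂ) = σ (AnticommutatorSpinAlgebra.y ℂ)) : ρ = σ := by
  have hz : ρ (AnticommutatorSpinAlgebra.z ℂ) = σ (AnticommutatorSpinAlgebra.z ℂ) := by
    have h1 := congrArg ρ spinAlgebra_xy
    have h2 := congrArg σ spinAlgebra_xy
    rw [map_add, map_mul, map_mul, map_smul, hx, hy] at h1
    rw [map_add, map_mul, map_mul, map_smul, h1] at h2
    have h3 := congrArg ((1 / 2 : ℂ) • ·) h2
    simpa [smul_smul] using h3
  refine RingQuot.ringQuot_ext' ℂ _ _ (FreeAlgebra.hom_ext (funext fun i => ?_))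
  fin_cases i
  · exact hx
  · exact hy
  · exact hz

open AntipodalVertex in
theorem existsUnique_representation (D : ℕ) (hodd : Odd D) (hD : 3 ≤ D)
    (u : AntipodalVertex D) :
    ∃! ρ : AnticommutatorSpinAlgebra ℂ →ₐ[ℂ] Matrix (AntipodalVertex D) (AntipodalVertex D) ℂ,
      ρ (AnticommutatorSpinAlgebra.x ℂ) = quotientAdjacency D ∧
      ρ (AnticommutatorSpinAlgebra.y ℂ) = quotientDualAdjacency D u := by
  let φ : FreeAlgebra ℂ (Fin 3) →ₐ[ℂ] Matrix (AntipodalVertex D) (AntipodalVertex D) ℂ :=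
    FreeAlgebra.lift ℂ ![quotientAdjacency D, quotientDualAdjacency D u, mixedAdjacency u]
  have hφ : ∀ ⦃a b : FreeAlgebra ℂ (Fin 3)⦄, AnticommutatorSpinRel ℂ a b → φ a = φ b := by
    intro a b hab
    cases hab <;>
      simp only [φ, map_add, map_mul, map_ofNat, FreeAlgebra.lift_ι_apply, Matrix.cons_val] <;>
      apply toLin_relation <;>
      rw [adjacency_mulVecLin hD, dualAdjacency_mulVecLin hodd hD, mixedAdjacency_mulVecLin]
    · exact (isSpinFamily hodd u).xy
    · exact (isSpinFamily hodd u).yz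
    · exact (isSpinFamily hodd u).zx
  refine ⟨RingQuot.liftAlgHom ℂ ⟨φ, hφ⟩, ⟨?_, ?_⟩, ?_⟩
  · rw [AnticommutatorSpinAlgebra.x, RingQuot.liftAlgHom_mkAlgHom_apply]
    simp [φ]
  · rw [AnticommutatorSpinAlgebra.y, RingQuot.liftAlgHom_mkAlgHom_apply]
    simp [φ]
  · rintro ρ ⟨hx, hy⟩
    refine spinAlgebra_hom_ext ?_ ?_
    · rw [hx, AnticommutatorSpinAlgebra.x, RingQuot.liftAlgHom_mkAlgHom_apply]
      simp [φ]
    · rw [hy, AnticommutatorSpinAlgebra.y, RingQuot.liftAlgHom_mkAlgHom_apply]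
      simp [φ]

open AntipodalVertex in
/-- The third generator acts as the mixed adjacency matrix. -/
theorem representation_z {D : ℕ} (hodd : Odd D) (hD : 3 ≤ D) (u : AntipodalVertex D)
    {ρ : AnticommutatorSpinAlgebra ℂ →ₐ[ℂ] Matrix (AntipodalVertex D) (AntipodalVertex D) ℂ}
    (hx : ρ (AnticommutatorSpinAlgebra.x ℂ) = quotientAdjacency D)
    (hy : ρ (AnticommutatorSpinAlgebra.y ℂ) = quotientDualAdjacency D u) :
    ρ (AnticommutatorSpinAlgebra.z ℂ) = mixedAdjacency u := by
  have h := congrArg ρ spinAlgebra_xy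
  rw [map_add, map_mul, map_mul, hx, hy, map_smul] at h
  have h2 : quotientAdjacency D * quotientDualAdjacency D u +
      quotientDualAdjacency D u * quotientAdjacency D = 2 * mixedAdjacency u := by
    apply toLin_relation
    rw [adjacency_mulVecLin hD, dualAdjacency_mulVecLin hodd hD, mixedAdjacency_mulVecLin]
    exact (isSpinFamily hodd u).xy
  rw [h2, two_mul, ← two_smul ℂ] at h
  exact (smul_right_injective _ (two_ne_zero (α := ℂ)) h).symm

open AntipodalVertex in
-- Irreducibility is only required against subspaces invariant under `A` and `B`, since these are
-- exactly what `isMatrixSubmodule_of_invariant` turns into Terwilliger modules.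
theorem restrict_leonardTriple {D : ℕ} (hodd : Odd D) (x : Fin D → Bool)
    {A B C : Module.End ℂ (AntipodalVertex D → ℂ)}
    (hA : A = ∑ i, shift i) (hB : B = ∑ i, dualShift (mk x) i)
    (hC : C = ∑ i, shift i * dualShift (mk x) i)
    {W : Submodule ℂ (AntipodalVertex D → ℂ)} (hW : W ≠ ⊥)
    (hirr : ∀ U ≤ W, (∀ w ∈ U, A w ∈ U) → (∀ w ∈ U, B w ∈ U) → U = ⊥ ∨ U = W)
    (hAW : ∀ w ∈ W, A w ∈ W) (hBW : ∀ w ∈ W, B w ∈ W) (hCW : ∀ w ∈ W, C w ∈ W) :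
    IsTotallyAlmostBipartiteLeonardTriple (A.restrict hAW) (B.restrict hBW) (C.restrict hCW) ∧
      IsBannaiItoType (A.restrict hAW) (B.restrict hBW) (C.restrict hCW) := by
  have hF := isSpinFamily hodd (mk x)
  have : Nontrivial W := Submodule.nontrivial_iff_ne_bot.2 hW
  have happ : ∀ {P Q S : Module.End ℂ (AntipodalVertex D → ℂ)}, P * Q + Q * P = 2 * S →
      ∀ w, P (Q w) + Q (P w) = (2 : ℂ) • S w := fun {P Q S} h w => by
    have := LinearMap.congr_fun h w
    rw [two_smul]
    rw [two_mul] at this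
    exact this
  have hspin : IsSpinTriple (A.restrict hAW) (B.restrict hBW) (C.restrict hCW) := by
    subst hA hB hC
    exact ⟨fun w => Subtype.ext (happ hF.xy w), fun w => Subtype.ext (happ hF.yz w),
      fun w => Subtype.ext (happ hF.zx w)⟩
  have hcard : Odd (Fintype.card (Fin D)) := by rwa [Fintype.card_fin]
  refine hspin.leonardTriple ?_ ?_ ?_ ?_
  · intro U hUA hUB _
    have h := hirr (U.map W.subtype) (Submodule.map_subtype_le W U) ?_ ?_
    · rcases h with h | h
      · exact Or.inl (Submodule.map_injective_of_injective W.injective_subtype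
          (h.trans (Submodule.map_bot _).symm))
      · refine Or.inr (Submodule.map_injective_of_injective W.injective_subtype ?_)
        rw [h, Submodule.map_top, Submodule.range_subtype]
    · rintro _ ⟨w, hw, rfl⟩
      exact ⟨_, hUA w hw, rfl⟩
    · rintro _ ⟨w, hw, rfl⟩
      exact ⟨_, hUB w hw, rfl⟩
  · exact hasOddEigenvalue_restrict shift (fun i j => LinearMap.congr_fun (hF.left_comm i j))
      (fun i => LinearMap.congr_fun (hF.left_sq i)) hcard
      (fun w => by rw [hA, LinearMap.sum_apply]) hW hAW
  · exact hasOddEigenvalue_restrict (dualShift (mk x))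
      (fun i j => LinearMap.congr_fun (hF.right_comm i j))
      (fun i => LinearMap.congr_fun (hF.right_sq i)) hcard
      (fun w => by rw [hB, LinearMap.sum_apply]) hW hBW
  · exact hasOddEigenvalue_restrict (fun i => shift i * dualShift (mk x) i)
      (fun i j => LinearMap.congr_fun (hF.mixed_comm i j))
      (fun i => LinearMap.congr_fun (hF.mixed_sq i)) hcard
      (fun w => by rw [hC, LinearMap.sum_apply]) hW hCW

theorem mainTheorem5 (D : ℕ) (hodd : Odd D) (hD : 3 ≤ D) (x : Fin D → Bool) :
    (∃! ρ : AnticommutatorSpinAlgebra ℂ →ₐ[ℂ] Matrix (AntipodalVertex D) (AntipodalVertex D) ℂ,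
      ρ (AnticommutatorSpinAlgebra.x ℂ) = quotientAdjacency D ∧
      ρ (AnticommutatorSpinAlgebra.y ℂ) = quotientDualAdjacency D (AntipodalVertex.mk x)) ∧
    ∀ ρ : AnticommutatorSpinAlgebra ℂ →ₐ[ℂ] Matrix (AntipodalVertex D) (AntipodalVertex D) ℂ,
      ρ (AnticommutatorSpinAlgebra.x ℂ) = quotientAdjacency D →
      ρ (AnticommutatorSpinAlgebra.y ℂ) = quotientDualAdjacency D (AntipodalVertex.mk x) →
      ∀ W : Submodule ℂ (AntipodalVertex D → ℂ),
        IsIrreducibleMatrixSubmodule (quotientTerwilliger D (AntipodalVertex.mk x)) W →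
        ∃ (hA : ∀ w ∈ W, (quotientAdjacency D).mulVecLin w ∈ W)
          (hB : ∀ w ∈ W, (quotientDualAdjacency D (AntipodalVertex.mk x)).mulVecLin w ∈ W)
          (hC : ∀ w ∈ W, (ρ (AnticommutatorSpinAlgebra.z ℂ)).mulVecLin w ∈ W),
          IsTotallyAlmostBipartiteLeonardTriple
            ((quotientAdjacency D).mulVecLin.restrict hA)
            ((quotientDualAdjacency D (AntipodalVertex.mk x)).mulVecLin.restrict hB)
            ((ρ (AnticommutatorSpinAlgebra.z ℂ)).mulVecLin.restrict hC) ∧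
          IsBannaiItoType
            ((quotientAdjacency D).mulVecLin.restrict hA)
            ((quotientDualAdjacency D (AntipodalVertex.mk x)).mulVecLin.restrict hB)
            ((ρ (AnticommutatorSpinAlgebra.z ℂ)).mulVecLin.restrict hC) := by
  refine ⟨existsUnique_representation D hodd hD _, fun ρ hx hy W ⟨hmod, hbot, hirr⟩ => ?_⟩
  have hA : ∀ w ∈ W, (quotientAdjacency D).mulVecLin w ∈ W :=
    hmod _ (AntipodalVertex.adjacency_mem x)
  have hB : ∀ w ∈ W, (quotientDualAdjacency D (AntipodalVertex.mk x)).mulVecLin w ∈ W :=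
    hmod _ (AntipodalVertex.dualAdjacency_mem hodd hD x)
  have hz : (ρ (AnticommutatorSpinAlgebra.z ℂ)).mulVecLin =
      ∑ i, AntipodalVertex.shift i * AntipodalVertex.dualShift (AntipodalVertex.mk x) i := by
    rw [representation_z hodd hD _ hx hy, AntipodalVertex.mixedAdjacency_mulVecLin]
  -- The relation `z = (xy + yx) / 2` puts the third matrix in the Terwilliger algebra.
  have hC : ∀ w ∈ W, (ρ (AnticommutatorSpinAlgebra.z ℂ)).mulVecLin w ∈ W := by
    refine hmod _ ?_
    have h := congrArg ρ spinAlgebra_xy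
    rw [map_add, map_mul, map_mul, hx, hy, map_smul] at h
    have hz' := congrArg ((1 / 2 : ℂ) • ·) h
    simp only [smul_smul] at hz'
    norm_num at hz'
    rw [← hz', ← smul_add]
    exact Subalgebra.smul_mem _ (Subalgebra.add_mem _
      (Subalgebra.mul_mem _ (AntipodalVertex.adjacency_mem x)
        (AntipodalVertex.dualAdjacency_mem hodd hD x))
      (Subalgebra.mul_mem _ (AntipodalVertex.dualAdjacency_mem hodd hD x)
        (AntipodalVertex.adjacency_mem x))) _
  exact ⟨hA, hB, hC, restrict_leonardTriple hodd x (AntipodalVertex.adjacency_mulVecLin hD)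
    (AntipodalVertex.dualAdjacency_mulVecLin hodd hD _) hz hbot
    (fun U hU hUA hUB => hirr U
      (AntipodalVertex.isMatrixSubmodule_of_invariant hodd hD x U hUA hUB) hU) hA hB hC⟩
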